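/- **Setting.** Let $D=[0,1]^2\ni(t,x)$. For $q\in L^2([0,1])$ put $\eta(q)(x)=\exp\int_0^x q$, $\varphi(q)(x)=\int_0^x\eta(q)$ and $\langle f,g\rangle_\eta=\int_0^1\eta(q) f g\,dx$. Let $Q=\{q\in L^2([0,1]) : \int_0^1 q=0,\ \int_0^1\eta(q)=1\}$; via $q=\partial_x\log\partial_x\varphi$ this is the group $\mathrm{Diff}_0^2([0,1])$, and the right-invariant metric $\int_0^1 u''v''\,dx$ becomes $\int_0^1 X^2/\eta(q)\,dx$. Let $T_q^*Q=\{p\in L^2([0,1]):\langle p,1\rangle_\eta=\langle p,\varphi\rangle_\eta=0\}$. With $H_2=\begin{pmatrix}1&1/2\\1/2&1/3\end{pmatrix}$ set $$\pi_q^*(f)=f-\begin{bmatrix}1&\varphi\end{bmatrix}H_2^{-1}\begin{bmatrix}\langle f,1\rangle_\eta\\ \langle f,\varphi\rangle_\eta\end{bmatrix},\qquad \mathcal U(f,q)(x)=\tfrac12\int_x^1\eta(q)\,f\,dy$$ (with the same formula for $\mathcal U$ when $f\,dy$ is replaced by a measure, integrated over $[x,1]$), and $$\pi_1(p,q)=\begin{bmatrix}1&\varphi\end{bmatrix}H_2^{-1}\begin{bmatrix}0\\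 \tfrac32\int_0^1\eta(q)\left(\int_0^x\eta(q)p\right)^2dx\end{bmatrix},\qquad \pi_2(q,f)=(\mathrm{id}-\pi_q^*)\,\mathcal U(f,q).$$ For a curve $(p,q)$ in $T^*Q$ with $\dot q=\eta(q)p$, the acceleration covector is $\left(\frac{D}{Dt}\dot q\right)^\flat=\dot p+\mathcal U(p^2,q)-\pi_1(p,q)-\pi_2(q,p^2)$, and $(p,q)$ is a geodesic if it vanishes. Let $\mathcal C$ be the set of curves $(p,q)$ in $T^*Q$, $t\in[0,1]$, with $q\in H^2([0,1],L^2([0,1]))$ and $\dot q=\eta(q)p$. Let $\mathcal M_0(D)$ be the set of finite positive measures $\Delta$ on $D$ which vanish at $t=0$ and whose time derivative is a measure, in the sense that there is a finite signed measure $\partial_t\Delta$ on $D$ with $\langle\Delta,\partial_t f\rangle+\langle\partial_t\Delta,f\rangle=0$ for all $f\in C(D)$ with $\partial_tf\in C(D)$ and $f(1,\cdot)=0$ (for all other finite positive measures on $D$, $\mathcal F$ is $+\infty$). Let $\mathrm{FR}_f(\mu,\nu)=\int_D r\left(\frac{d\mu}{d\lambda},\frac{d\nu}{d\lambda}\right)f\,d\lambda$,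 where $\lambda$ is any finite measure dominating $\mu,\nu$, and $r(x,y)=\frac{y^2}{4x}$ if $x>0$, $r(0,0)=0$, $r=+\infty$ otherwise. For a penalty $P:L^2\times L^2\to\mathbb R$ and $\Delta=\int_0^1\Delta_t\,dt$, the relaxed functional is $$\mathcal F(\Delta,p,q)=\mathrm{FR}_{\eta(q)}(\Delta,\partial_t\Delta)+\int_0^1\!\!\int_0^1\eta(q)\left[\left(\tfrac{D}{Dt}\dot q\right)^\flat+\pi_q^*\big(\mathcal U(\Delta_t,q)\big)\right]^2dx\,dt+P(p(1),q(1))\in(-\infty,+\infty].$$ **Proposition.** There exists a geodesic $(p_0,q_0)$, defined for $t\in[0,\infty)$, starting at the identity ($q_0(0)=0$) with initial momentum $m_0=\delta_{1/4}-\delta_{3/4}$, that is, $\int_0^1p_0(0,x)\,h''(x)\,dx=h(\tfrac14)-h(\tfrac34)$ for all $h\in C^2$ with $h=h'=0$ at $0$ and $1$, for which the Jacobian $t\mapsto\eta(q_0(t))(\tfrac12)$ is strictly decreasing on $[0,\infty)$ and tends to $0$ as $t\to\infty$, and for which there is a smooth time reparametrization $\alpha$ (with $\alpha(0)=0$ and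 $\dot\alpha>0$ on $[0,1]$) such that the curve $(p(t),q(t))=(\dot\alpha(t)\,p_0(\alpha(t)),\,q_0(\alpha(t)))$, $t\in[0,1]$, belongs to $\mathcal C$ and, for every penalty $P$, $\Delta=0$ is not a minimizer of $\Delta\mapsto\mathcal F(\Delta,p,q)$ over $\mathcal M_0(D)$. -/

import Mathlib

open MeasureTheory Set Filter Topology
open scoped ENNReal ContDiff

noncomputable section

namespace DiffSpline

/-! ### The manifold `Q` of one-dimensional `H²₀` diffeomorphisms and its cotangent bundle -/

/-- Lebesgue measure on the space interval `[0,1]`. -/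
abbrev leb01 : Measure ℝ := volume.restrict (Icc (0 : ℝ) 1)

/-- The Hilbert space `L²([0,1])`. -/
abbrev L2 : Type := Lp ℝ 2 leb01

/-- `η(q)(x) = exp (∫₀ˣ q)`, the Jacobian `∂ₓφ` of the diffeomorphism `φ` with coordinate
`q = ∂ₓ log ∂ₓφ`. -/
def eta (q : L2) (x : ℝ) : ℝ := Real.exp (∫ u in (0 : ℝ)..x, q u)

/-- `φ(q)(x) = ∫₀ˣ η(q)`, the diffeomorphism itself. -/
def phi (q : L2) (x : ℝ) : ℝ := ∫ y in (0 : ℝ)..x, eta q y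

/-- The Hilbert submanifold `Q` of `L²([0,1])`. -/
def Q : Set L2 :=
  {q | ∫ x in (0 : ℝ)..1, q x = 0 ∧ ∫ x in (0 : ℝ)..1, eta q x = 1}

/-- The inner product `⟨f, g⟩_η = ∫₀¹ η(q) f g` of covectors at `q`. -/
def innerEta (q : L2) (f g : ℝ → ℝ) : ℝ := ∫ x in (0 : ℝ)..1, eta q x * f x * g x

/-- The cotangent space at `q`: those `p` for which `η(q) p` is tangent to `Q` at `q`, i.e.
`⟨p, 1⟩_η = 0` and `⟨p, φ⟩_η = 0`. -/
def cotangent (q : L2) : Set L2 :=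
  {p | innerEta q p (fun _ => 1) = 0 ∧ innerEta q p (phi q) = 0}

/-- The Hilbert matrix, which is the Gram matrix of `1, φ` for `⟨·,·⟩_η`. -/
def H2 : Matrix (Fin 2) (Fin 2) ℝ := !![1, 1 / 2; 1 / 2, 1 / 3]

/-- The function `[1 φ] H₂⁻¹ [a; b]`. -/
def gramComb (q : L2) (a b : ℝ) (x : ℝ) : ℝ :=
  dotProduct ![1, phi q x] (Matrix.mulVec H2⁻¹ ![a, b])

theorem H2_inv : H2⁻¹ = !![4, -6; -6, 12] := by
  apply Matrix.inv_eq_right_inv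
  ext i j
  fin_cases i <;> fin_cases j <;> norm_num [H2, Matrix.mul_apply, Fin.sum_univ_two]

theorem gramComb_eq (q : L2) (a b x : ℝ) :
    gramComb q a b x = (4 * a - 6 * b) + (12 * b - 6 * a) * phi q x := by
  rw [gramComb, H2_inv]
  simp [Matrix.mulVec, dotProduct, Fin.sum_univ_two]
  ring

/-- The projection `π_q^*` onto the cotangent space at `q`. -/
def projStar (q : L2) (f : ℝ → ℝ) (x : ℝ) : ℝ :=
  f x - gramComb q (innerEta q f (fun _ => 1)) (innerEta q f (phi q)) x

/-- The nonlocal operator `𝒰(f, q)(x) = ½ ∫ₓ¹ η(q) f` for a function `f`. -/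
def opU (f : ℝ → ℝ) (q : L2) (x : ℝ) : ℝ := (1 / 2) * ∫ y in x..1, eta q y * f y

/-- The nonlocal operator `𝒰(m, q)(x) = ½ ∫_{[x,1]} η(q) dm` for a measure `m`. -/
def opUMeas (m : Measure ℝ) (q : L2) (x : ℝ) : ℝ := (1 / 2) * ∫ y in Icc x 1, eta q y ∂m

/-- The coefficient `b = (3/2) ∫₀¹ (∫₀ˣ p ∘ φ⁻¹)² dx`, written in the variable `φ⁻¹(x)`. -/
def coeffB (p q : L2) : ℝ :=
  (3 / 2) * ∫ x in (0 : ℝ)..1, eta q x * (∫ y in (0 : ℝ)..x, eta q y * p y) ^ 2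

/-- `π₁(p, q) = [1 φ] H₂⁻¹ [0; b]`. -/
def pi1 (p q : L2) (x : ℝ) : ℝ := gramComb q 0 (coeffB p q) x

/-- `π₂(q, f) = (id - π_q^*)(𝒰(f, q))`. -/
def pi2 (q : L2) (f : ℝ → ℝ) (x : ℝ) : ℝ := opU f q x - projStar q (opU f q) x

/-- The covector `(D/Dt q̇)^♭ = ṗ + 𝒰(p², q) - π₁ - π₂` of the covariant acceleration of a curve,
computed from the values of `p`, `q` and `ṗ` (here `r`) at one time. -/
def accelFlat (p q r : L2) (x : ℝ) : ℝ :=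
  r x + opU (fun y => p y ^ 2) q x - pi1 p q x - pi2 q (fun y => p y ^ 2) x

/-! ### Geodesics -/

/-- `(p, q)` is a geodesic of `Q` on `[0, ∞)` in Hamiltonian coordinates: a curve in `T^*Q` with
`q̇ = η(q) p` and `ṗ = -½ ∫ₓ¹ η(q) p² + π₁ + π₂`, derivatives being taken in `L²([0,1])`. -/
structure IsGeodesic (p q : ℝ → L2) : Prop where
  mem_Q : ∀ t, 0 ≤ t → q t ∈ Q
  mem_cotangent : ∀ t, 0 ≤ t → p t ∈ cotangent (q t)
  velocity : ∀ t, 0 ≤ t → ∃ v : L2, HasDerivWithinAt q v (Ici 0) t ∧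
    ∀ᵐ x ∂leb01, v x = eta (q t) x * p t x
  momentum : ∀ t, 0 ≤ t → ∃ r : L2, HasDerivWithinAt p r (Ici 0) t ∧
    ∀ᵐ x ∂leb01, accelFlat (p t) (q t) r x = 0

/-- At the identity, where `p` is the second derivative `v''` of a vector field `v ∈ H²₀([0,1])`,
the momentum `m = L v ∈ H^{-2}`, given by `⟨m, h⟩ = ∫₀¹ v'' h''` for test functions `h` vanishing
to first order at `0` and `1`, is the sum of Dirac masses `∑ i, c i • δ_{y i}`. -/
def HasDiracMomentumAtId {n : ℕ} (p : L2) (c y : Fin n → ℝ) : Prop :=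
  p ∈ cotangent 0 ∧
  ∀ h : ℝ → ℝ, ContDiff ℝ 2 h → h 0 = 0 → h 1 = 0 → deriv h 0 = 0 → deriv h 1 = 0 →
    ∫ x in (0 : ℝ)..1, p x * deriv (deriv h) x = ∑ i, c i * h (y i)

/-- `(p, q)` is the landmark geodesic issued from the identity (`q = 0`) with initial momentum
`∑ i, c i • δ_{y i}`. -/
structure IsLandmarkGeodesic {n : ℕ} (c y : Fin n → ℝ) (p q : ℝ → L2) : Prop where
  geodesic : IsGeodesic p q
  start : q 0 = 0
  start_momentum : HasDiracMomentumAtId (p 0) c y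

/-! ### Curves of finite acceleration -/

/-- `u ∈ H¹([0,1], L²([0,1]))`, for the continuous representative. -/
def MemH1 (u : ℝ → L2) : Prop :=
  ∃ g : ℝ → L2, MemLp g 2 leb01 ∧ ∀ t ∈ Icc (0 : ℝ) 1, u t = u 0 + ∫ s in (0 : ℝ)..t, g s

/-- `u ∈ H²([0,1], L²([0,1]))`, for the `C¹` representative. -/
def MemH2 (u : ℝ → L2) : Prop :=
  ∃ v : ℝ → L2, MemH1 v ∧ ∀ t ∈ Icc (0 : ℝ) 1, HasDerivWithinAt u (v t) (Icc 0 1) t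

/-- The class `𝒞⁰` of curves in `T^*Q` over the time interval `[0,1]` with initial values
`(pi, qi)`. -/
structure IsCurve (pi qi : L2) (p q : ℝ → L2) : Prop where
  memH2 : MemH2 q
  mem_Q : ∀ t ∈ Icc (0 : ℝ) 1, q t ∈ Q
  mem_cotangent : ∀ t ∈ Icc (0 : ℝ) 1, p t ∈ cotangent (q t)
  velocity : ∀ t ∈ Icc (0 : ℝ) 1, ∃ v : L2, HasDerivWithinAt q v (Icc 0 1) t ∧
    ∀ᵐ x ∂leb01, v x = eta (q t) x * p t x
  start_p : p 0 = pi
  start_q : q 0 = qi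

/-- A smooth, strictly increasing time reparametrization `[0,1] → [0, α(1)]`. -/
structure IsTimeReparam (α : ℝ → ℝ) : Prop where
  smooth : ContDiff ℝ ∞ α
  start : α 0 = 0
  deriv_pos : ∀ t ∈ Icc (0 : ℝ) 1, 0 < deriv α t

/-! ### The Fisher-Rao functional -/

/-- The time-space square `D = [0,1]²`; points are `(t, x)`. -/
def D : Set (ℝ × ℝ) := Icc (0 : ℝ) 1 ×ˢ Icc (0 : ℝ) 1

/-- The one-homogeneous convex function `r`. -/
def frIntegrand (x y : ℝ) : ℝ≥0∞ :=
  if 0 < x then ENNReal.ofReal (1 / 4 * (y ^ 2 / x)) else if x = 0 ∧ y = 0 then 0 else ⊤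

/-- The Fisher-Rao functional `FR_f(μ, ν) = ∫ r(dμ/dλ, dν/dλ) f dλ`, for the dominating measure
`λ = μ + |ν|` (by one-homogeneity of `r`, its choice is immaterial). -/
def fisherRao (f : ℝ × ℝ → ℝ) (μ : Measure (ℝ × ℝ)) (ν : SignedMeasure (ℝ × ℝ)) : ℝ≥0∞ :=
  ∫⁻ z, frIntegrand (μ.rnDeriv (μ + ν.totalVariation) z).toReal
      (ν.rnDeriv (μ + ν.totalVariation) z) * ENNReal.ofReal (f z) ∂(μ + ν.totalVariation)

/-- `f ∈ C_{1,0}(D)`, with time derivative `ft`. -/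
structure IsC10 (f ft : ℝ × ℝ → ℝ) : Prop where
  cont : ContinuousOn f D
  cont_deriv : ContinuousOn ft D
  hasDeriv : ∀ t ∈ Icc (0 : ℝ) 1, ∀ x ∈ Icc (0 : ℝ) 1,
    HasDerivWithinAt (fun s => f (s, x)) (ft (t, x)) (Icc 0 1) t

/-- The signed measure `δ` on `D` is `∂_t Δ`, and `Δ` vanishes at time `0`, in the weak sense:
`⟨∂_t f, Δ⟩ + ⟨f, δ⟩ = 0` for all `f ∈ C_{1,0}(D)` with `f(1, ·) = 0`. -/
def IsTimeDeriv (Δ : Measure (ℝ × ℝ)) (δ : SignedMeasure (ℝ × ℝ)) : Prop :=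
  δ.totalVariation Dᶜ = 0 ∧
  ∀ f ft : ℝ × ℝ → ℝ, IsC10 f ft → (∀ x ∈ Icc (0 : ℝ) 1, f (1, x) = 0) →
    ∫ z, ft z ∂Δ + ∫ᵛ z, f z ∂<•δ = 0

/-- The positive finite measures `Δ` on `D` that vanish at time `0` and have a time derivative
which is a measure (all others have infinite relaxed energy). -/
def M0 : Set (FiniteMeasure (ℝ × ℝ)) :=
  {Δ | (Δ : Measure (ℝ × ℝ)) Dᶜ = 0 ∧ ∃ δ, IsTimeDeriv Δ δ}

/-! ### The relaxed functional -/

/-- The disintegration `Δ_t` of `Δ = ∫ Δ_t dt` at time `t`: the conditional measure at `t` times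
the density of the time marginal of `Δ`. -/
def slice (Δ : FiniteMeasure (ℝ × ℝ)) (t : ℝ) : Measure ℝ :=
  ((Δ : Measure (ℝ × ℝ)).fst.rnDeriv volume t) • (Δ : Measure (ℝ × ℝ)).condKernel t

/-- `FR_η(Δ, ∂_t Δ)`, equal to `+∞` if `∂_t Δ` is not a measure. (The weak equation determines
`∂_t Δ` up to a part carried by `{t = 1}`; a nonzero such part makes `FR_η` infinite, so that the
infimum is the value at the time derivative.) -/
def fisherRaoPath (q : ℝ → L2) (Δ : FiniteMeasure (ℝ × ℝ)) : ℝ≥0∞ :=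
  ⨅ (δ : SignedMeasure (ℝ × ℝ)) (_ : IsTimeDeriv Δ δ),
    fisherRao (fun z => eta (q z.1) z.2) Δ δ

/-- The relaxed functional, minimized over `ν`, as a function of the defect measure `Δ`:
`ℱ(Δ, p, q) = FR_η(Δ, ∂_t Δ) + ∫₀¹ ‖(D/Dt q̇)^♭ + π_q^*(𝒰(Δ, q))‖²_q dt + P(p(1), q(1))`,
where `‖f‖²_q = ∫₀¹ η(q) f²`. -/
def relaxedF (P : L2 → L2 → ℝ) (p q : ℝ → L2) (Δ : FiniteMeasure (ℝ × ℝ)) : EReal :=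
  ((fisherRaoPath q Δ + ∫⁻ t in Icc (0 : ℝ) 1, ∫⁻ x in Icc (0 : ℝ) 1,
      ENNReal.ofReal (eta (q t) x * (accelFlat (p t) (q t) (deriv p t) x +
        projStar (q t) (opUMeas (slice Δ t) (q t)) x) ^ 2) : ℝ≥0∞) : EReal) +
    ((P (p 1) (q 1) : ℝ) : EReal)

end DiffSpline

end

/-!
By symmetry, the geodesic with initial momentum `δ_{1/4} - δ_{3/4}` has momentum
`m (δ_a - δ_{1-a})` at all times, and `(a, m)` solves an ordinary differential equation along which
the two landmarks approach the midpoint. With `m = 3k / (2 (1/2 - a))`, the quantity `k a²` stays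
bounded below, so the velocity field remains compressive at the midpoint and the Jacobian
`E(t) = η(q₀(t))(1/2)` decays exponentially.

For any geodesic `p₀` run along a time change `α`, the acceleration covector is `α'' p₀(α)`. Adding
the defect `ε α² dt ⊗ δ_{1/2}` changes the relaxed energy to first order in `ε` by
`∫₀¹ E(α) α'² + α'' α² E'(α) dt`. If `α' = l (α + A)`, so that `α'' = l α'`, this integrates to
`l (E(R) R² + ∫₀ᴿ E(r) (A - r) dr)` with `R = α(1)`, which is negative for `R` large and `A` small
because `E(R) R² → 0`.
-/

noncomputable section

namespace DiffSpline

open Metric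
open scoped NNReal

/-! ### Global integral curves -/

section ODE

variable {E : Type*} [NormedAddCommGroup E] [NormedSpace ℝ E]

/-- A time-dependent vector field is Lipschitz on every ball around the origin, uniformly over
bounded time intervals. -/
def LipschitzOnBounded (F : ℝ → E → E) : Prop :=
  ∀ T R : ℝ, ∃ K : ℝ≥0, ∀ t ∈ Icc (-T) T, LipschitzOnWith K (F t) (closedBall 0 R)

theorem lipschitzOnBounded_of_contDiff [FiniteDimensional ℝ E] {f : E → E} (hf : ContDiff ℝ 1 f) :
    LipschitzOnBounded fun _ => f := fun _ R => by
  obtain ⟨K, hK⟩ := hf.locallyLipschitz.locallyLipschitzOn.exists_lipschitzOnWith_of_compact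
    (isCompact_closedBall (0 : E) R)
  exact ⟨K, fun _ _ => hK⟩

variable {F : ℝ → E → E}

theorem LipschitzOnBounded.eqOn_Ioo (hF : LipschitzOnBounded F) {f g : ℝ → E} {T : ℝ}
    (hf : IsIntegralCurveOn f F (Ioo (-T) T)) (hg : IsIntegralCurveOn g F (Ioo (-T) T))
    (h0 : f 0 = g 0) : EqOn f g (Ioo (-T) T) := by
  intro t ht
  obtain ⟨S, htS, hST⟩ := exists_between (abs_lt.2 ht)
  have hS : 0 < S := (abs_nonneg t).trans_lt htS
  have hsub : Icc (-S) S ⊆ Ioo (-T) T := Icc_subset_Ioo (neg_lt_neg hST) hST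
  have bounded {u : ℝ → E} (hu : IsIntegralCurveOn u F (Ioo (-T) T)) :
      ∃ R, ∀ s ∈ Icc (-S) S, ‖u s‖ ≤ R :=
    isCompact_Icc.exists_bound_of_continuousOn (hu.continuousOn.mono hsub)
  obtain ⟨R₁, hR₁⟩ := bounded hf
  obtain ⟨R₂, hR₂⟩ := bounded hg
  obtain ⟨K, hK⟩ := hF S (max R₁ R₂)
  have hasDerivAt {u : ℝ → E} (hu : IsIntegralCurveOn u F (Ioo (-T) T)) {s : ℝ}
      (hs : s ∈ Ioo (-S) S) : HasDerivAt u (F s (u s)) s :=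
    have hsT := hsub (Ioo_subset_Icc_self hs)
    (hu s hsT).hasDerivAt (isOpen_Ioo.mem_nhds hsT)
  exact ODE_solution_unique_of_mem_Ioo (s := fun _ => closedBall 0 (max R₁ R₂))
    (fun s hs => hK s (Ioo_subset_Icc_self hs)) ⟨neg_lt_zero.2 hS, hS⟩
    (fun s hs => ⟨hasDerivAt hf hs, mem_closedBall_zero_iff.2
      ((hR₁ s (Ioo_subset_Icc_self hs)).trans (le_max_left _ _))⟩)
    (fun s hs => ⟨hasDerivAt hg hs, mem_closedBall_zero_iff.2
      ((hR₂ s (Ioo_subset_Icc_self hs)).trans (le_max_right _ _))⟩) h0 (abs_lt.1 htS)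

theorem LipschitzOnBounded.integralCurve_unique (hF : LipschitzOnBounded F) {f g : ℝ → E}
    (hf : IsIntegralCurve f F) (hg : IsIntegralCurve g F) (h0 : f 0 = g 0) : f = g := by
  ext t
  exact hF.eqOn_Ioo (hf.isIntegralCurveOn _) (hg.isIntegralCurveOn _) h0
    (abs_lt.1 (lt_add_one |t|))

theorem LipschitzOnBounded.exists_isIntegralCurve_of_forall_nat (hF : LipschitzOnBounded F)
    {x₀ : E} (hloc : ∀ n : ℕ, ∃ u : ℝ → E, u 0 = x₀ ∧ IsIntegralCurveOn u F (Ioo (-n) n)) :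
    ∃ u : ℝ → E, u 0 = x₀ ∧ IsIntegralCurve u F := by
  choose u hu0 hu using hloc
  have hagree {m n : ℕ} (hmn : m ≤ n) : EqOn (u m) (u n) (Ioo (-m) m) :=
    have hmn' : (m : ℝ) ≤ n := Nat.cast_le.2 hmn
    hF.eqOn_Ioo (hu m) ((hu n).mono (Ioo_subset_Ioo (neg_le_neg hmn') hmn'))
      ((hu0 m).trans (hu0 n).symm)
  let N : ℝ → ℕ := fun t => ⌈|t|⌉₊ + 1
  have hN (t : ℝ) : t ∈ Ioo (-(N t : ℝ)) (N t) := by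
    refine abs_lt.1 ((Nat.le_ceil |t|).trans_lt ?_)
    exact_mod_cast Nat.lt_succ_self _
  have hglue (t : ℝ) (n : ℕ) (ht : t ∈ Ioo (-(n : ℝ)) n) : u (N t) t = u n t :=
    (le_total (N t) n).elim (fun h => hagree h (hN t)) fun h => (hagree h ht).symm
  refine ⟨fun t => u (N t) t, hu0 _, fun t => ?_⟩
  have hnhds : Ioo (-(N t : ℝ)) (N t) ∈ 𝓝 t := isOpen_Ioo.mem_nhds (hN t)
  refine ((hu (N t) t (hN t)).hasDerivAt hnhds).congr_of_eventuallyEq ?_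
  filter_upwards [hnhds] with s hs using hglue s _ hs

theorem LipschitzOnBounded.exists_isIntegralCurve [CompleteSpace E] (hF : LipschitzOnBounded F)
    (hbound : ∀ T : ℝ, ∃ L : ℝ≥0, ∀ t ∈ Icc (-T) T, ∀ x, ‖F t x‖ ≤ L)
    (hcont : ∀ x, Continuous fun t => F t x) (x₀ : E) :
    ∃ u : ℝ → E, u 0 = x₀ ∧ IsIntegralCurve u F := by
  refine hF.exists_isIntegralCurve_of_forall_nat fun n => ?_
  obtain ⟨L, hL⟩ := hbound n
  obtain ⟨K, hK⟩ := hF n (‖x₀‖ + L * n)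
  have hPL : IsPicardLindelof F (tmin := -(n : ℝ)) (tmax := n) ⟨0, by simp, n.cast_nonneg⟩ x₀
      (L * n) 0 L K := by
    refine ⟨fun t ht => (hK t ht).mono (closedBall_subset_closedBall' ?_),
      fun x _ => (hcont x).continuousOn, fun t ht x _ => hL t ht x, ?_⟩ <;>
    simp [add_comm]
  obtain ⟨u, hu0, hu⟩ := hPL.exists_eq_forall_mem_Icc_hasDerivWithinAt₀
  exact ⟨u, hu0, fun t ht => (hu t (Ioo_subset_Icc_self ht)).mono Ioo_subset_Icc_self⟩

end ODE

section ContDiffTwo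

variable {E : Type*} [NormedAddCommGroup E] [NormedSpace ℝ E] {u : ℝ → E} (hu : ContDiff ℝ 2 u)
include hu

theorem hasDerivAt_of_contDiff_two (t : ℝ) : HasDerivAt u (deriv u t) t :=
  (hu.differentiable two_ne_zero t).hasDerivAt

theorem hasDerivAt_deriv_of_contDiff_two (t : ℝ) :
    HasDerivAt (deriv u) (deriv (deriv u) t) t :=
  (hu.differentiable_deriv_two t).hasDerivAt

theorem continuous_deriv_deriv_of_contDiff_two : Continuous (deriv (deriv u)) :=
  (contDiff_succ_iff_deriv.1 hu).2.2.continuous_deriv le_rfl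

end ContDiffTwo

/-! ### Functions depending continuously on time -/

section TimeDependent

variable {f f' : ℝ → ℝ → ℝ}

theorem continuous_of_continuous_uncurry (hf : Continuous (Function.uncurry f)) (t : ℝ) :
    Continuous (f t) :=
  hf.comp (Continuous.prodMk_right t)

theorem eventually_forall_Icc_abs_sub_lt (hf : Continuous (Function.uncurry f)) (t a b : ℝ)
    {ε : ℝ} (hε : 0 < ε) : ∀ᶠ s in 𝓝 t, ∀ x ∈ Icc a b, |f s x - f t x| < ε := by
  obtain ⟨v, hv, h⟩ := IsCompact.mem_uniformity_of_prod (s := univ) (k := Icc a b) isCompact_Icc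
    hf.continuousOn (mem_univ t) (dist_mem_uniformity hε)
  rw [nhdsWithin_univ] at hv
  filter_upwards [hv] with s hs x hx using h s hs x hx

theorem exists_abs_le_of_mem_Icc (hf : Continuous (Function.uncurry f)) (T a b : ℝ) :
    ∃ M : ℝ≥0, ∀ t ∈ Icc (-T) T, ∀ x ∈ Icc a b, |f t x| ≤ M := by
  obtain ⟨M, hM⟩ := (isCompact_Icc.prod isCompact_Icc).exists_bound_of_continuousOn
    (s := Icc (-T) T ×ˢ Icc a b) hf.continuousOn
  exact ⟨M.toNNReal, fun t ht x hx => (hM (t, x) ⟨ht, hx⟩).trans (Real.le_coe_toNNReal M)⟩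

theorem hasDerivAt_intervalIntegral (hf : Continuous (Function.uncurry f))
    (hf' : Continuous (Function.uncurry f')) {a b : ℝ} (hab : a ≤ b)
    (h : ∀ t, ∀ y ∈ Icc a b, HasDerivAt (fun s => f s y) (f' t y) t) (t : ℝ) :
    HasDerivAt (fun s => ∫ y in a..b, f s y) (∫ y in a..b, f' t y) t := by
  obtain ⟨M, hM⟩ := exists_abs_le_of_mem_Icc hf' (|t| + 1) a b
  have hsub : uIoc a b ⊆ Icc a b := uIoc_of_le hab ▸ Ioc_subset_Icc_self
  exact (intervalIntegral.hasDerivAt_integral_of_dominated_loc_of_deriv_le (bound := fun _ => M)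
    (isOpen_Ioo.mem_nhds (abs_lt.1 (lt_add_one |t|)))
    (Eventually.of_forall fun s => (continuous_of_continuous_uncurry hf s).aestronglyMeasurable)
    ((continuous_of_continuous_uncurry hf t).intervalIntegrable a b)
    (continuous_of_continuous_uncurry hf' t).aestronglyMeasurable
    (ae_of_all _ fun y hy s hs => hM s (Ioo_subset_Icc_self hs) y (hsub hy))
    intervalIntegrable_const (ae_of_all _ fun y hy s _ => h s y (hsub hy))).2

end TimeDependent

/-! ### Continuous functions as elements of `L²` -/

section ToL2

/-- The class in `L²([0,1])` of a square-integrable function; other functions are sent to `0`, so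
that no proof of integrability enters the definition of a curve in `L²`. -/
def toL2 (f : ℝ → ℝ) : L2 :=
  open Classical in if h : MemLp f 2 leb01 then h.toLp f else 0

theorem ae_leb01_of_forall {p : ℝ → Prop} (h : ∀ x ∈ Icc (0 : ℝ) 1, p x) : ∀ᵐ x ∂leb01, p x :=
  (ae_restrict_iff' measurableSet_Icc).2 (ae_of_all _ h)

theorem memLp_of_continuousOn {E : Type*} [NormedAddCommGroup E] {f : ℝ → E}
    (hf : ContinuousOn f (Icc 0 1)) : MemLp f 2 leb01 := by
  obtain ⟨M, hM⟩ := isCompact_Icc.exists_bound_of_continuousOn hf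
  exact MemLp.of_bound (hf.aestronglyMeasurable_of_isCompact isCompact_Icc measurableSet_Icc) M
    (ae_leb01_of_forall hM)

theorem coeFn_toL2 {f : ℝ → ℝ} (hf : Continuous f) : toL2 f =ᵐ[leb01] f := by
  rw [toL2, dif_pos (memLp_of_continuousOn hf.continuousOn)]
  exact MemLp.coeFn_toLp _

theorem norm_L2_le_of_ae_bound {u : L2} {M : ℝ} (hM : 0 ≤ M) (h : ∀ᵐ x ∂leb01, |u x| ≤ M) :
    ‖u‖ ≤ M := by
  simpa [measureUnivNNReal] using Lp.norm_le_of_ae_bound (f := u) hM h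

variable {f f' : ℝ → ℝ → ℝ}

theorem continuous_toL2 (hf : Continuous (Function.uncurry f)) :
    Continuous fun t => toL2 (f t) := by
  have hcont := continuous_of_continuous_uncurry hf
  refine continuous_iff_continuousAt.2 fun t => Metric.tendsto_nhds.2 fun ε hε => ?_
  filter_upwards [eventually_forall_Icc_abs_sub_lt hf t 0 1 (half_pos hε)] with s hs
  rw [dist_eq_norm]
  refine (norm_L2_le_of_ae_bound (half_pos hε).le ?_).trans_lt (half_lt_self hε)
  filter_upwards [Lp.coeFn_sub (toL2 (f s)) (toL2 (f t)), coeFn_toL2 (hcont s),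
    coeFn_toL2 (hcont t), ae_leb01_of_forall hs] with x hsub hfs hft hx
  rw [hsub, Pi.sub_apply, hfs, hft]
  exact hx.le

theorem abs_sub_sub_mul_le {f f' : ℝ → ℝ} {s t δ ε : ℝ} (hs : s ∈ ball t δ)
    (h : ∀ r, HasDerivAt f (f' r) r) (hf' : ∀ r ∈ ball t δ, |f' r - f' t| < ε) :
    |f s - f t - (s - t) * f' t| ≤ ε * |s - t| := by
  have := (convex_ball t δ).norm_image_sub_le_of_norm_hasDerivWithin_le
    (f := fun r => f r - r * f' t) (f' := fun r => f' r - 1 * f' t)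
    (fun r _ => ((h r).sub ((hasDerivAt_id r).mul_const _)).hasDerivWithinAt)
    (fun r hr => by simpa using (hf' r hr).le) (mem_ball_self (pos_of_mem_ball hs)) hs
  simp only [Real.norm_eq_abs] at this
  convert this using 2
  ring

theorem hasDerivAt_toL2 (hf : Continuous (Function.uncurry f))
    (hf' : Continuous (Function.uncurry f'))
    (h : ∀ t, ∀ x ∈ Icc (0 : ℝ) 1, HasDerivAt (fun s => f s x) (f' t x) t) (t : ℝ) :
    HasDerivAt (fun s => toL2 (f s)) (toL2 (f' t)) t := by
  have hcont := continuous_of_continuous_uncurry hf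
  rw [hasDerivAt_iff_isLittleO, Asymptotics.isLittleO_iff]
  intro ε hε
  obtain ⟨δ, hδ, hball⟩ := eventually_nhds_iff_ball.1
    (eventually_forall_Icc_abs_sub_lt hf' t 0 1 hε)
  filter_upwards [ball_mem_nhds t hδ] with s hs
  refine norm_L2_le_of_ae_bound (by positivity) ?_
  filter_upwards [Lp.coeFn_sub (toL2 (f s) - toL2 (f t)) ((s - t) • toL2 (f' t)),
    Lp.coeFn_sub (toL2 (f s)) (toL2 (f t)), Lp.coeFn_smul (s - t) (toL2 (f' t)),
    coeFn_toL2 (hcont s), coeFn_toL2 (hcont t),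
    coeFn_toL2 (continuous_of_continuous_uncurry hf' t),
    ae_restrict_mem measurableSet_Icc] with x hsub₂ hsub₁ hsmul hfs hft hft' hx
  rw [hsub₂, Pi.sub_apply, hsub₁, Pi.sub_apply, hsmul, Pi.smul_apply, hfs, hft, hft', smul_eq_mul]
  exact abs_sub_sub_mul_le (f := fun r => f r x) (f' := fun r => f' r x) hs (fun r => h r x hx)
    fun r hr => hball r hr x hx

end ToL2

/-! ### The Eulerian velocity of two symmetric landmarks -/

section Field

theorem hasDerivAt_comp_max {f f' : ℝ → ℝ} (hf : ∀ x, HasDerivAt f (f' x) x) {a : ℝ}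
    (ha : f' a = 0) (y : ℝ) : HasDerivAt (fun y => f (max y a)) (f' (max y a)) y := by
  rcases lt_trichotomy y a with h | rfl | h
  · rw [max_eq_right h.le, ha]
    refine (hasDerivAt_const y (f a)).congr_of_eventuallyEq ?_
    filter_upwards [Iio_mem_nhds h] with z hz
    rw [max_eq_right (le_of_lt hz)]
  · rw [max_self, ← hasDerivWithinAt_univ, ← Iic_union_Ici (a := y)]
    refine HasDerivWithinAt.union ?_ ?_
    · rw [ha]
      exact (hasDerivWithinAt_const y _ (f y)).congr
        (fun z hz => by rw [max_eq_right (mem_Iic.1 hz)]) (by rw [max_self])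
    · exact (hf y).hasDerivWithinAt.congr
        (fun z hz => by rw [max_eq_left (mem_Ici.1 hz)]) (by rw [max_self])
  · rw [max_eq_left h.le]
    refine (hf y).congr_of_eventuallyEq ?_
    filter_upwards [Ioi_mem_nhds h] with z hz
    rw [max_eq_left (le_of_lt hz)]

theorem hasDerivAt_comp_min {f f' : ℝ → ℝ} (hf : ∀ x, HasDerivAt f (f' x) x) {a : ℝ}
    (ha : f' a = 0) (y : ℝ) : HasDerivAt (fun y => f (min y a)) (f' (min y a)) y := by
  have hneg (x : ℝ) : HasDerivAt (fun x => f (-x)) (-f' (-x)) x := by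
    simpa [Function.comp_def] using (hf (-x)).scomp x (hasDerivAt_neg x)
  simpa [Function.comp_def, max_neg_neg] using
    (hasDerivAt_comp_max hneg (a := -a) (by simp [ha]) (-y)).scomp y (hasDerivAt_neg y)

theorem hasDerivAt_max_sub_pow (b : ℝ) (n : ℕ) (y : ℝ) :
    HasDerivAt (fun y => (max y b - b) ^ (n + 2)) ((n + 2) * (max y b - b) ^ (n + 1)) y := by
  refine hasDerivAt_comp_max (f := fun y => (y - b) ^ (n + 2))
    (f' := fun y => (n + 2) * (y - b) ^ (n + 1)) (fun x => ?_) (by simp) y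
  simpa using ((hasDerivAt_id x).sub_const b).fun_pow (n + 2)

/-- The coefficient of `y ^ 2` in `landmarkField`. -/
def quadCoeff (a k : ℝ) : ℝ := 3 / 2 * k * a * (1 - a)

/-- The coefficient of `-y ^ 3` in `landmarkField`. -/
def cubicCoeff (a k : ℝ) : ℝ := k * (1 / 2 + a - a ^ 2)

/-- The momentum of the left landmark. Scaling by `1 / 2 - a` makes the equations of motion for
`a` and `k` polynomial. -/
def landmarkMomentum (a k : ℝ) : ℝ := 3 * k / (2 * (1 / 2 - a))

/-- The Eulerian velocity of the landmarks at `a` and `1 - a` with momenta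
`±landmarkMomentum a k`: the cubic spline `v` on `[0, 1]` with knots at the landmarks for which
`v'''' = landmarkMomentum a k • (δ_a - δ_{1 - a})` and `v = v' = 0` at `0` and `1`. -/
def landmarkField (a k y : ℝ) : ℝ :=
  quadCoeff a k * y ^ 2 - cubicCoeff a k * y ^ 3 +
    landmarkMomentum a k / 6 * (max y a - a) ^ 3 -
    landmarkMomentum a k / 6 * (max y (1 - a) - (1 - a)) ^ 3

/-- The first spatial derivative of `landmarkField`. -/
def landmarkFieldDeriv (a k y : ℝ) : ℝ :=
  2 * quadCoeff a k * y - 3 * cubicCoeff a k * y ^ 2 +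
    landmarkMomentum a k / 2 * (max y a - a) ^ 2 -
    landmarkMomentum a k / 2 * (max y (1 - a) - (1 - a)) ^ 2

/-- The second spatial derivative of `landmarkField`. -/
def landmarkFieldDeriv₂ (a k y : ℝ) : ℝ :=
  2 * quadCoeff a k - 6 * cubicCoeff a k * y + landmarkMomentum a k * (max y a - a) -
    landmarkMomentum a k * (max y (1 - a) - (1 - a))

theorem hasDerivAt_landmarkField (a k y : ℝ) :
    HasDerivAt (landmarkField a k) (landmarkFieldDeriv a k y) y := by
  have h := ((((hasDerivAt_pow 2 y).const_mul (quadCoeff a k)).fun_sub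
    ((hasDerivAt_pow 3 y).const_mul (cubicCoeff a k))).fun_add
    ((hasDerivAt_max_sub_pow a 1 y).const_mul (landmarkMomentum a k / 6))).fun_sub
    ((hasDerivAt_max_sub_pow (1 - a) 1 y).const_mul (landmarkMomentum a k / 6))
  refine h.congr_deriv ?_
  push_cast [landmarkFieldDeriv]
  ring

theorem hasDerivAt_landmarkFieldDeriv (a k y : ℝ) :
    HasDerivAt (landmarkFieldDeriv a k) (landmarkFieldDeriv₂ a k y) y := by
  have h := ((((hasDerivAt_id' y).const_mul (2 * quadCoeff a k)).fun_sub
    ((hasDerivAt_pow 2 y).const_mul (3 * cubicCoeff a k))).fun_add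
    ((hasDerivAt_max_sub_pow a 0 y).const_mul (landmarkMomentum a k / 2))).fun_sub
    ((hasDerivAt_max_sub_pow (1 - a) 0 y).const_mul (landmarkMomentum a k / 2))
  refine h.congr_deriv ?_
  push_cast [landmarkFieldDeriv₂]
  ring

theorem continuous_landmarkFieldDeriv₂ (a k : ℝ) : Continuous (landmarkFieldDeriv₂ a k) := by
  unfold landmarkFieldDeriv₂
  fun_prop

variable {a k : ℝ}

theorem landmarkMomentum_mul (ha : a < 1 / 2) :
    landmarkMomentum a k * (1 / 2 - a) = 3 / 2 * k := by
  have : 1 / 2 - a ≠ 0 := sub_ne_zero.2 ha.ne'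
  rw [landmarkMomentum, div_mul_eq_mul_div, mul_div_mul_right _ _ this]
  ring

theorem landmarkField_zero (h0 : 0 < a) (ha : a < 1 / 2) : landmarkField a k 0 = 0 := by
  rw [landmarkField, max_eq_right h0.le, max_eq_right (by linarith)]
  ring

theorem landmarkField_one (h0 : 0 < a) (ha : a < 1 / 2) : landmarkField a k 1 = 0 := by
  rw [landmarkField, max_eq_left (by linarith), max_eq_left (by linarith), quadCoeff, cubicCoeff]
  linear_combination (1 - a + a ^ 2) / 3 * landmarkMomentum_mul (k := k) ha

theorem landmarkField_half (ha : a < 1 / 2) : landmarkField a k (1 / 2) = 0 := by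
  rw [landmarkField, max_eq_left (by linarith), max_eq_right (by linarith), quadCoeff, cubicCoeff]
  linear_combination (1 / 2 - a) ^ 2 / 6 * landmarkMomentum_mul (k := k) ha

theorem landmarkFieldDeriv_zero (h0 : 0 < a) (ha : a < 1 / 2) : landmarkFieldDeriv a k 0 = 0 := by
  rw [landmarkFieldDeriv, max_eq_right h0.le, max_eq_right (by linarith)]
  ring

theorem landmarkFieldDeriv_one (h0 : 0 < a) (ha : a < 1 / 2) : landmarkFieldDeriv a k 1 = 0 := by
  rw [landmarkFieldDeriv, max_eq_left (by linarith), max_eq_left (by linarith), quadCoeff,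
    cubicCoeff]
  linear_combination landmarkMomentum_mul (k := k) ha

theorem landmarkFieldDeriv_half (ha : a < 1 / 2) :
    landmarkFieldDeriv a k (1 / 2) = -(3 / 4) * k * a ^ 2 := by
  rw [landmarkFieldDeriv, max_eq_left (by linarith), max_eq_right (by linarith), quadCoeff,
    cubicCoeff]
  linear_combination (1 / 2 - a) / 2 * landmarkMomentum_mul (k := k) ha

end Field

/-! ### The equations of motion -/

section EquationsOfMotion

/-- The velocity of the left landmark. -/
def landmarkVelocity (a k : ℝ) : ℝ := k * a ^ 3 * (1 / 2 - a) * (2 - a)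

/-- The time derivative of `k` along a solution. -/
def strengthRate (a k : ℝ) : ℝ := -2 * k ^ 2 * (1 / 2 - a) * a ^ 2 * (3 / 2 - a)

variable {a k : ℝ}

theorem landmarkField_left (ha : a < 1 / 2) : landmarkField a k a = landmarkVelocity a k := by
  rw [landmarkField, max_self, max_eq_right (by linarith), quadCoeff, cubicCoeff, landmarkVelocity]
  ring

theorem landmarkField_right (ha : a < 1 / 2) :
    landmarkField a k (1 - a) = -landmarkVelocity a k := by
  rw [landmarkField, max_self, max_eq_left (by linarith), quadCoeff, cubicCoeff, landmarkVelocity]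
  linear_combination (4 / 3 * (1 / 2 - a) ^ 2) * landmarkMomentum_mul (k := k) ha

theorem landmarkFieldDeriv_left (ha : a < 1 / 2) :
    landmarkFieldDeriv a k a = k * a ^ 2 * (3 / 2 - 6 * a + 3 * a ^ 2) := by
  rw [landmarkFieldDeriv, max_self, max_eq_right (by linarith), quadCoeff, cubicCoeff]
  ring

theorem landmarkFieldDeriv_right (ha : a < 1 / 2) :
    landmarkFieldDeriv a k (1 - a) = k * a ^ 2 * (3 / 2 - 6 * a + 3 * a ^ 2) := by
  rw [landmarkFieldDeriv, max_self, max_eq_left (by linarith), quadCoeff, cubicCoeff]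
  linear_combination (2 * (1 / 2 - a)) * landmarkMomentum_mul (k := k) ha

/-- The time derivative of `quadCoeff` along a solution. -/
def quadCoeffRate (a k : ℝ) : ℝ :=
  3 / 2 * (strengthRate a k * a * (1 - a) + k * landmarkVelocity a k * (1 - 2 * a))

/-- The time derivative of `cubicCoeff` along a solution. -/
def cubicCoeffRate (a k : ℝ) : ℝ :=
  strengthRate a k * (1 / 2 + a - a ^ 2) + k * landmarkVelocity a k * (1 - 2 * a)

/-- The material derivative of `landmarkFieldDeriv₂` along a solution. At a landmark `b`, the
momentum equation `ṁ = -m v'(b)` and the transport of `b` by `v` combine into the first order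
remainder of `v` at `b`, which makes this function differentiable in space. -/
def materialDeriv (a k y : ℝ) : ℝ :=
  2 * quadCoeffRate a k - 6 * cubicCoeffRate a k * y - 6 * cubicCoeff a k * landmarkField a k y +
    landmarkMomentum a k * (landmarkField a k (max y a) - landmarkField a k a -
      landmarkFieldDeriv a k a * (max y a - a)) -
    landmarkMomentum a k * (landmarkField a k (max y (1 - a)) - landmarkField a k (1 - a) -
      landmarkFieldDeriv a k (1 - a) * (max y (1 - a) - (1 - a)))

theorem hasDerivAt_landmarkField_remainder (a k b y : ℝ) :
    HasDerivAt (fun y => landmarkField a k (max y b) - landmarkField a k b -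
        landmarkFieldDeriv a k b * (max y b - b))
      (landmarkFieldDeriv a k (max y b) - landmarkFieldDeriv a k b) y := by
  refine hasDerivAt_comp_max (f := fun y => landmarkField a k y - landmarkField a k b -
      landmarkFieldDeriv a k b * (y - b))
    (f' := fun y => landmarkFieldDeriv a k y - landmarkFieldDeriv a k b)
    (fun x => ?_) (sub_self _) y
  simpa using ((hasDerivAt_landmarkField a k x).sub_const _).fun_sub
    (((hasDerivAt_id x).sub_const b).const_mul (landmarkFieldDeriv a k b))

theorem hasDerivAt_materialDeriv (a k y : ℝ) : HasDerivAt (materialDeriv a k)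
    (-6 * cubicCoeffRate a k - 6 * cubicCoeff a k * landmarkFieldDeriv a k y +
      landmarkMomentum a k * (landmarkFieldDeriv a k (max y a) - landmarkFieldDeriv a k a) -
      landmarkMomentum a k *
        (landmarkFieldDeriv a k (max y (1 - a)) - landmarkFieldDeriv a k (1 - a))) y := by
  have h := (((((hasDerivAt_id' y).const_mul (6 * cubicCoeffRate a k)).const_sub
    (2 * quadCoeffRate a k)).fun_sub
    ((hasDerivAt_landmarkField a k y).const_mul (6 * cubicCoeff a k))).fun_add
    ((hasDerivAt_landmarkField_remainder a k a y).const_mul (landmarkMomentum a k))).fun_sub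
    ((hasDerivAt_landmarkField_remainder a k (1 - a) y).const_mul (landmarkMomentum a k))
  exact h.congr_deriv (by ring)

theorem hasDerivAt_materialDeriv_eq_half_sq_add (ha : a < 1 / 2) (y : ℝ) :
    HasDerivAt (materialDeriv a k) (1 / 2 * landmarkFieldDeriv₂ a k y ^ 2 +
      (-6 * cubicCoeffRate a k - 2 * quadCoeff a k ^ 2)) y := by
  refine (hasDerivAt_materialDeriv a k y).congr_deriv ?_
  have hlt : a ≤ 1 - a := by linarith
  rcases le_total y a with h₁ | h₁
  · simp only [landmarkFieldDeriv, landmarkFieldDeriv₂, max_eq_right h₁,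
      max_eq_right (h₁.trans hlt), max_self, max_eq_right hlt, max_eq_left hlt]
    ring
  · rcases le_total y (1 - a) with h₂ | h₂ <;>
    · simp only [landmarkFieldDeriv, landmarkFieldDeriv₂, max_eq_left h₁, h₂, max_eq_right,
        max_eq_left, max_self, hlt]
      ring

theorem exists_affine_materialDeriv (ha : a < 1 / 2) : ∃ c d : ℝ, ∀ y,
    materialDeriv a k y + (1 / 2) * ∫ s in y..1, landmarkFieldDeriv₂ a k s ^ 2 = c + d * y := by
  have hcont : Continuous fun s => landmarkFieldDeriv₂ a k s ^ 2 :=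
    (continuous_landmarkFieldDeriv₂ a k).pow 2
  set d : ℝ := -6 * cubicCoeffRate a k - 2 * quadCoeff a k ^ 2
  refine ⟨materialDeriv a k 1 - d, d, fun y => ?_⟩
  have hFTC : ∫ s in y..1, (1 / 2 * landmarkFieldDeriv₂ a k s ^ 2 + d) =
      materialDeriv a k 1 - materialDeriv a k y :=
    intervalIntegral.integral_eq_sub_of_hasDerivAt
      (fun s _ => hasDerivAt_materialDeriv_eq_half_sq_add ha s)
      (((hcont.const_mul _).add continuous_const).intervalIntegrable _ _)
  rw [intervalIntegral.integral_add ((hcont.const_mul _).intervalIntegrable _ _)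
    intervalIntegrable_const, intervalIntegral.integral_const_mul,
    intervalIntegral.integral_const, smul_eq_mul] at hFTC
  linear_combination hFTC

end EquationsOfMotion

/-! ### The trajectory of the landmarks -/

section Trajectory

theorem lt_integralCurve_of_equilibrium {f : ℝ → ℝ} (hf : ContDiff ℝ 1 f) {c : ℝ} (hc : f c = 0)
    {u : ℝ → ℝ} (hu : IsIntegralCurve u fun _ => f) (h0 : c < u 0) (t : ℝ) : c < u t := by
  by_contra! ht
  have hmem : c ∈ uIcc (u 0) (u t) := ⟨(min_le_right _ _).trans ht, h0.le.trans (le_max_left _ _)⟩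
  obtain ⟨s, -, hs⟩ := intermediate_value_uIcc hu.continuous.continuousOn hmem
  have hconst : IsIntegralCurve (fun _ => c) fun _ => f := fun r =>
    (hasDerivAt_const r c).congr_deriv hc.symm
  have heq : u ∘ (· + s) = fun _ => c :=
    (lipschitzOnBounded_of_contDiff hf).integralCurve_unique (hu.comp_add s) hconst
      (by simpa using hs)
  have := congrFun heq (-s)
  simp only [Function.comp_apply, neg_add_cancel] at this
  exact h0.ne' this

/-- The equation of motion in the coordinate `z = √(2 / a - 1)`. On the energy level of the initial
condition, `k` is a function of `z`, and the resulting scalar vector field is bounded. -/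
def zField (z : ℝ) : ℝ := -(√7 / 192) * ((z ^ 2 - 3) / (z ^ 2 + 1))

theorem contDiff_zField : ContDiff ℝ 1 zField := by
  unfold zField
  exact contDiff_const.mul (ContDiff.div (by fun_prop) (by fun_prop) fun z => by positivity)

theorem norm_zField_le (z : ℝ) : ‖zField z‖ ≤ √7 / 192 * 3 := by
  have h : |(z ^ 2 - 3) / (z ^ 2 + 1)| ≤ 3 := by
    rw [abs_div, abs_of_pos (by positivity : 0 < z ^ 2 + 1), div_le_iff₀ (by positivity), abs_le]
    constructor <;> nlinarith [sq_nonneg z]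
  rw [zField, Real.norm_eq_abs, neg_mul, abs_neg, abs_mul, abs_of_nonneg (by positivity)]
  gcongr

theorem exists_isIntegralCurve_zField :
    ∃ z : ℝ → ℝ, z 0 = √7 ∧ IsIntegralCurve z fun _ => zField :=
  (lipschitzOnBounded_of_contDiff contDiff_zField).exists_isIntegralCurve
    (fun _ => ⟨⟨√7 / 192 * 3, by positivity⟩, fun _ _ => norm_zField_le⟩)
    (fun _ => continuous_const) _

variable {z : ℝ → ℝ}

theorem sqrt_three_lt_of_isIntegralCurve (hz : IsIntegralCurve z fun _ => zField) (h0 : z 0 = √7)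
    (t : ℝ) : √3 < z t :=
  lt_integralCurve_of_equilibrium contDiff_zField (by norm_num [zField]) hz
    (h0 ▸ Real.sqrt_lt_sqrt (by norm_num) (by norm_num)) t

theorem antitone_of_isIntegralCurve (hz : IsIntegralCurve z fun _ => zField) (h0 : z 0 = √7) :
    Antitone z := by
  refine antitone_of_hasDerivAt_nonpos hz fun t => ?_
  have hlt := sqrt_three_lt_of_isIntegralCurve hz h0 t
  have hsq : 3 ≤ z t ^ 2 := (Real.sqrt_le_left (Real.sqrt_nonneg 3 |>.trans hlt.le)).1 hlt.le
  exact mul_nonpos_of_nonpos_of_nonneg (neg_nonpos.2 (by positivity))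
    (div_nonneg (sub_nonneg.2 hsq) (by positivity))

theorem hasDerivAt_position (hz : IsIntegralCurve z fun _ => zField) {t : ℝ} (hpos : 0 < z t) :
    HasDerivAt (fun t => 2 / (z t ^ 2 + 1))
      (landmarkVelocity (2 / (z t ^ 2 + 1)) (√7 / 96 * (z t ^ 2 + 1) ^ 2 / (4 * z t))) t := by
  refine ((hasDerivAt_const t 2).fun_div (((hz t).fun_pow 2).add_const 1)
    (by positivity)).congr_deriv ?_
  simp only [landmarkVelocity, zField]
  field_simp
  ring

theorem hasDerivAt_strength (hz : IsIntegralCurve z fun _ => zField) {t : ℝ} (hpos : 0 < z t) :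
    HasDerivAt (fun t => √7 / 96 * (z t ^ 2 + 1) ^ 2 / (4 * z t))
      (strengthRate (2 / (z t ^ 2 + 1)) (√7 / 96 * (z t ^ 2 + 1) ^ 2 / (4 * z t))) t := by
  refine ((((((hz t).fun_pow 2).add_const 1).fun_pow 2).const_mul (√7 / 96)).fun_div
    ((hz t).const_mul 4) (by positivity)).congr_deriv ?_
  simp only [strengthRate, zField]
  field_simp
  ring

/-- A trajectory `(a, 1 - a)` of the two landmarks, issued from `(1 / 4, 3 / 4)` with momenta
`(1, -1)`. -/
structure IsTrajectory (a k : ℝ → ℝ) : Prop where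
  hasDerivAt_position : ∀ t, HasDerivAt a (landmarkVelocity (a t) (k t)) t
  hasDerivAt_strength : ∀ t, HasDerivAt k (strengthRate (a t) (k t)) t
  pos : ∀ t, 0 < a t
  lt_half : ∀ t, a t < 1 / 2
  position_zero : a 0 = 1 / 4
  strength_zero : k 0 = 1 / 6

theorem exists_isTrajectory : ∃ a k : ℝ → ℝ, IsTrajectory a k ∧
    ∃ c > 0, ∀ t, 0 ≤ t → c ≤ k t * a t ^ 2 := by
  obtain ⟨z, h0, hz⟩ := exists_isIntegralCurve_zField
  have hlt := sqrt_three_lt_of_isIntegralCurve hz h0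
  have hpos (t : ℝ) : 0 < z t := (Real.sqrt_pos.2 three_pos).trans (hlt t)
  have h7 : √7 ^ 2 = 7 := Real.sq_sqrt (by norm_num)
  refine ⟨fun t => 2 / (z t ^ 2 + 1), fun t => √7 / 96 * (z t ^ 2 + 1) ^ 2 / (4 * z t),
    { hasDerivAt_position := fun t => hasDerivAt_position hz (hpos t)
      hasDerivAt_strength := fun t => hasDerivAt_strength hz (hpos t)
      pos := fun t => by positivity
      lt_half := fun t => ?_
      position_zero := by simp only [h0, h7]; norm_num
      strength_zero := by simp only [h0, h7]; field_simp; norm_num },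
    √7 / 96 / √7, by positivity, fun t ht => ?_⟩
  · rw [div_lt_div_iff₀ (by positivity) two_pos]
    linarith [(Real.sqrt_lt' (hpos t)).1 (hlt t)]
  · have hle : z t ≤ √7 := h0 ▸ antitone_of_isIntegralCurve hz h0 ht
    have := hpos t
    calc √7 / 96 / √7 ≤ √7 / 96 / z t := by gcongr
      _ = √7 / 96 * (z t ^ 2 + 1) ^ 2 / (4 * z t) * (2 / (z t ^ 2 + 1)) ^ 2 := by
          field_simp
          ring

end Trajectory

/-! ### The flow of a vector field on `[0, 1]` -/

section Clamp

/-- The nearest point of `[0, 1]`, as a real number. Composing with it makes a vector field on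
`[0, 1]` bounded on the whole line. -/
def clamp (y : ℝ) : ℝ := projIcc (0 : ℝ) 1 zero_le_one y

theorem clamp_mem (y : ℝ) : clamp y ∈ Icc (0 : ℝ) 1 := Subtype.coe_prop _

theorem clamp_of_mem {y : ℝ} (hy : y ∈ Icc (0 : ℝ) 1) : clamp y = y := by
  rw [clamp, projIcc_of_mem _ hy]

theorem continuous_clamp : Continuous clamp := continuous_subtype_val.comp continuous_projIcc

theorem hasDerivAt_comp_clamp {f f' : ℝ → ℝ} (hf : ∀ x, HasDerivAt f (f' x) x) (h0 : f' 0 = 0)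
    (h1 : f' 1 = 0) (y : ℝ) : HasDerivAt (fun y => f (clamp y)) (f' (clamp y)) y := by
  have hclamp (y : ℝ) : clamp y = max (min y 1) 0 := by
    rw [clamp, coe_projIcc, max_comm, min_comm]
  simpa only [hclamp] using
    hasDerivAt_comp_min (f := fun y => f (max y 0)) (f' := fun y => f' (max y 0))
      (hasDerivAt_comp_max hf h0) (by rw [max_eq_left zero_le_one, h1]) y

theorem exists_abs_comp_clamp_sub_le {f f' : ℝ → ℝ → ℝ} (hf' : Continuous (Function.uncurry f'))
    (h : ∀ t y, HasDerivAt (f t) (f' t y) y) (T : ℝ) : ∃ M : ℝ≥0, ∀ t ∈ Icc (-T) T,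
      ∀ y z, |f t (clamp y) - f t (clamp z)| ≤ M * |y - z| := by
  obtain ⟨M, hM⟩ := exists_abs_le_of_mem_Icc hf' T 0 1
  refine ⟨M, fun t ht y z => ?_⟩
  calc |f t (clamp y) - f t (clamp z)| ≤ M * |clamp y - clamp z| :=
        (convex_Icc (0 : ℝ) 1).norm_image_sub_le_of_norm_hasDerivWithin_le
          (fun x _ => (h t x).hasDerivWithinAt) (fun x hx => hM t ht x hx) (clamp_mem z)
          (clamp_mem y)
    _ ≤ M * |y - z| := mul_le_mul_of_nonneg_left (abs_projIcc_sub_projIcc zero_le_one) M.2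

theorem abs_exp_sub_exp_le {x y R : ℝ} (hx : |x| ≤ R) (hy : |y| ≤ R) :
    |Real.exp x - Real.exp y| ≤ Real.exp R * |x - y| :=
  (convex_Icc (-R) R).norm_image_sub_le_of_norm_hasDerivWithin_le
    (fun z _ => (Real.hasDerivAt_exp z).hasDerivWithinAt)
    (fun z hz => by
      rw [Real.norm_eq_abs, Real.abs_exp]
      exact Real.exp_le_exp.2 hz.2) (abs_le.1 hy) (abs_le.1 hx)

end Clamp

section LogJacobian

/-- The map of `[0, 1]` that fixes `0` and has logarithmic Jacobian `u`. -/
def mapOfLogJac (u : C(Icc (0 : ℝ) 1, ℝ)) (x : ℝ) : ℝ :=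
  ∫ y in (0 : ℝ)..x, Real.exp (IccExtend zero_le_one u y)

theorem continuous_exp_IccExtend (u : C(Icc (0 : ℝ) 1, ℝ)) :
    Continuous fun y => Real.exp (IccExtend zero_le_one u y) :=
  Real.continuous_exp.comp u.continuous.Icc_extend'

theorem continuous_mapOfLogJac (u : C(Icc (0 : ℝ) 1, ℝ)) : Continuous (mapOfLogJac u) :=
  intervalIntegral.continuous_primitive
    (fun _ _ => (continuous_exp_IccExtend u).intervalIntegrable _ _) 0

theorem abs_mapOfLogJac_sub_le {u u' : C(Icc (0 : ℝ) 1, ℝ)} {R : ℝ} (hu : u ∈ closedBall 0 R)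
    (hu' : u' ∈ closedBall 0 R) (x : Icc (0 : ℝ) 1) :
    |mapOfLogJac u x - mapOfLogJac u' x| ≤ Real.exp R * dist u u' := by
  have abs_le {w : C(Icc (0 : ℝ) 1, ℝ)} (hw : w ∈ closedBall 0 R) (y : ℝ) :
      |IccExtend zero_le_one w y| ≤ R :=
    (w.norm_coe_le_norm _).trans (mem_closedBall_zero_iff.1 hw)
  have hpointwise (y : ℝ) : ‖Real.exp (IccExtend zero_le_one u y) -
      Real.exp (IccExtend zero_le_one u' y)‖ ≤ Real.exp R * dist u u' := by
    refine (abs_exp_sub_exp_le (abs_le hu y) (abs_le hu' y)).trans ?_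
    gcongr
    exact ContinuousMap.dist_apply_le_dist (f := u) (g := u') _
  rw [mapOfLogJac, mapOfLogJac, ← intervalIntegral.integral_sub
    ((continuous_exp_IccExtend u).intervalIntegrable _ _)
    ((continuous_exp_IccExtend u').intervalIntegrable _ _)]
  refine (intervalIntegral.norm_integral_le_of_norm_le_const fun y _ => hpointwise y).trans ?_
  refine mul_le_of_le_one_right (by positivity) ?_
  rw [sub_zero, abs_of_nonneg x.2.1]
  exact x.2.2

/-- If `φ` is the flow of `V`, its logarithmic Jacobian `u` solves `u̇ = V' ∘ φ`, where `φ` is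
recovered from `u`. This is the right-hand side, with `v = V'`. -/
def logJacField (v : ℝ → ℝ → ℝ) (hv : Continuous (Function.uncurry v)) (t : ℝ)
    (u : C(Icc (0 : ℝ) 1, ℝ)) : C(Icc (0 : ℝ) 1, ℝ) where
  toFun x := v t (clamp (mapOfLogJac u x))
  continuous_toFun := (continuous_of_continuous_uncurry hv t).comp
    (continuous_clamp.comp ((continuous_mapOfLogJac u).comp continuous_subtype_val))

variable {v w : ℝ → ℝ → ℝ} (hv : Continuous (Function.uncurry v))

theorem exists_norm_logJacField_le (T : ℝ) :
    ∃ L : ℝ≥0, ∀ t ∈ Icc (-T) T, ∀ u, ‖logJacField v hv t u‖ ≤ L := by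
  obtain ⟨M, hM⟩ := exists_abs_le_of_mem_Icc hv T 0 1
  exact ⟨M, fun t ht u => (ContinuousMap.norm_le _ M.2).2 fun x => hM t ht _ (clamp_mem _)⟩

theorem continuous_logJacField (u : C(Icc (0 : ℝ) 1, ℝ)) :
    Continuous fun t => logJacField v hv t u :=
  ContinuousMap.continuous_of_continuous_uncurry _ <| hv.comp <| continuous_fst.prodMk <|
    continuous_clamp.comp <| (continuous_mapOfLogJac u).comp <|
      continuous_subtype_val.comp continuous_snd

theorem lipschitzOnBounded_logJacField (hw : Continuous (Function.uncurry w))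
    (hvw : ∀ t y, HasDerivAt (v t) (w t y) y) : LipschitzOnBounded (logJacField v hv) := by
  intro T R
  obtain ⟨M, hM⟩ := exists_abs_comp_clamp_sub_le hw hvw T
  refine ⟨M * (Real.exp R).toNNReal, fun t ht => LipschitzOnWith.of_dist_le_mul
    fun u hu u' hu' => (ContinuousMap.dist_le (by positivity)).2 fun x => ?_⟩
  calc |v t (clamp (mapOfLogJac u x)) - v t (clamp (mapOfLogJac u' x))|
      ≤ M * |mapOfLogJac u x - mapOfLogJac u' x| := hM t ht _ _
    _ ≤ M * (Real.exp R * dist u u') := by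
        gcongr
        exact abs_mapOfLogJac_sub_le hu hu' x
    _ = _ := by rw [NNReal.coe_mul, Real.coe_toNNReal _ (Real.exp_pos R).le, mul_assoc]

theorem exists_logJac (hv : Continuous (Function.uncurry v)) (hw : Continuous (Function.uncurry w))
    (hvw : ∀ t y, HasDerivAt (v t) (w t y) y) :
    ∃ U : ℝ → ℝ → ℝ, Continuous (Function.uncurry U) ∧ (∀ x, U 0 x = 0) ∧
      ∀ t, ∀ x ∈ Icc (0 : ℝ) 1, HasDerivAt (fun s => U s x)
        (v t (clamp (∫ y in (0 : ℝ)..x, Real.exp (U t y)))) t := by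
  obtain ⟨u, hu0, hu⟩ := (lipschitzOnBounded_logJacField hv hw hvw).exists_isIntegralCurve
    (exists_norm_logJacField_le hv) (continuous_logJacField hv) 0
  refine ⟨fun t => IccExtend zero_le_one (u t), ?_, fun x => ?_, fun t x hx => ?_⟩
  · exact (hu.continuous.comp continuous_fst).eval (continuous_projIcc.comp continuous_snd)
  · simp only [hu0, IccExtend_apply, ContinuousMap.zero_apply]
  · simp only [IccExtend_of_mem zero_le_one _ hx]
    exact (ContinuousMap.evalCLM ℝ (⟨x, hx⟩ : Icc (0 : ℝ) 1)).hasFDerivAt.comp_hasDerivAt t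
      (hu t)

end LogJacobian

section Flow

/-- A time-dependent vector field `V` on `[0, 1]` that vanishes to first order at `0` and `1`, with
spatial derivatives `v` and `w` of first and second order. -/
structure IsClampedField (V v w : ℝ → ℝ → ℝ) : Prop where
  continuous : Continuous (Function.uncurry V)
  continuous_deriv : Continuous (Function.uncurry v)
  continuous_deriv₂ : Continuous (Function.uncurry w)
  hasDerivAt : ∀ t y, HasDerivAt (V t) (v t y) y
  hasDerivAt_deriv : ∀ t y, HasDerivAt (v t) (w t y) y
  left : ∀ t, V t 0 = 0
  right : ∀ t, V t 1 = 0
  deriv_left : ∀ t, v t 0 = 0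
  deriv_right : ∀ t, v t 1 = 0

/-- The flow `φ` of the time-dependent vector field `V` on `[0, 1]`, together with its logarithmic
Jacobian `U`; `v` is the spatial derivative of `V`. -/
structure IsFlow (V v U φ : ℝ → ℝ → ℝ) : Prop where
  continuous_logJac : Continuous (Function.uncurry U)
  continuous_map : Continuous (Function.uncurry φ)
  logJac_zero : ∀ x, U 0 x = 0
  map_zero : ∀ x, φ 0 x = x
  map_left : ∀ t, φ t 0 = 0
  map_right : ∀ t, φ t 1 = 1
  hasDerivAt_space : ∀ t x, HasDerivAt (φ t) (Real.exp (U t x)) x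
  hasDerivAt_logJac : ∀ t, ∀ x ∈ Icc (0 : ℝ) 1, HasDerivAt (fun s => U s x) (v t (φ t x)) t
  hasDerivAt_map : ∀ t, ∀ x ∈ Icc (0 : ℝ) 1, HasDerivAt (fun s => φ s x) (V t (φ t x)) t
  unique : ∀ f : ℝ → ℝ, IsIntegralCurve f V → (∀ t, f t ∈ Icc (0 : ℝ) 1) → ∀ t, φ t (f 0) = f t

variable {V v w U : ℝ → ℝ → ℝ}

theorem continuous_uncurry_integral_exp (hU : Continuous (Function.uncurry U)) :
    Continuous (Function.uncurry fun t x => ∫ y in (0 : ℝ)..x, Real.exp (U t y)) :=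
  intervalIntegral.continuous_parametric_intervalIntegral_of_continuous
    (f := fun (p : ℝ × ℝ) y => Real.exp (U p.1 y)) (s := fun p => p.2)
    ((Real.continuous_exp.comp hU).comp
      ((continuous_fst.comp continuous_fst).prodMk continuous_snd)) continuous_snd

theorem hasDerivAt_integral_exp (hU : Continuous (Function.uncurry U)) (t x : ℝ) :
    HasDerivAt (fun x => ∫ y in (0 : ℝ)..x, Real.exp (U t y)) (Real.exp (U t x)) x :=
  ((Real.continuous_exp.comp (continuous_of_continuous_uncurry hU t)).integral_hasStrictDerivAt
    0 x).hasDerivAt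

theorem IsClampedField.hasDerivAt_time_integral_exp (hV : IsClampedField V v w)
    (hUc : Continuous (Function.uncurry U))
    (hU : ∀ t, ∀ x ∈ Icc (0 : ℝ) 1, HasDerivAt (fun s => U s x)
      (v t (clamp (∫ y in (0 : ℝ)..x, Real.exp (U t y)))) t)
    (t : ℝ) {x : ℝ} (hx : x ∈ Icc (0 : ℝ) 1) :
    HasDerivAt (fun s => ∫ y in (0 : ℝ)..x, Real.exp (U s y))
      (V t (clamp (∫ y in (0 : ℝ)..x, Real.exp (U t y)))) t := by
  set φ : ℝ → ℝ → ℝ := fun t x => ∫ y in (0 : ℝ)..x, Real.exp (U t y)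
  have hexp : Continuous (Function.uncurry fun s y => Real.exp (U s y)) :=
    Real.continuous_exp.comp hUc
  have hrate : Continuous (Function.uncurry fun s y => Real.exp (U s y) * v s (clamp (φ s y))) :=
    hexp.mul (hV.continuous_deriv.comp (continuous_fst.prodMk
      (continuous_clamp.comp (continuous_uncurry_integral_exp hUc))))
  have hchain (y : ℝ) : HasDerivAt (fun y => V t (clamp (φ t y)))
      (Real.exp (U t y) * v t (clamp (φ t y))) y :=
    ((hasDerivAt_comp_clamp (hV.hasDerivAt t) (hV.deriv_left t) (hV.deriv_right t) _).comp y
      (hasDerivAt_integral_exp hUc t y)).congr_deriv (mul_comm _ _)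
  have hFTC : ∫ y in (0 : ℝ)..x, Real.exp (U t y) * v t (clamp (φ t y)) = V t (clamp (φ t x)) := by
    rw [intervalIntegral.integral_eq_sub_of_hasDerivAt (fun y _ => hchain y)
      ((continuous_of_continuous_uncurry hrate t).intervalIntegrable _ _)]
    simp only [φ, intervalIntegral.integral_same]
    rw [clamp_of_mem (left_mem_Icc.2 zero_le_one), hV.left, sub_zero]
  exact (hasDerivAt_intervalIntegral hexp hrate hx.1
    (fun s y hy => (hU s y ⟨hy.1, hy.2.trans hx.2⟩).exp) t).congr_deriv hFTC

theorem lipschitzOnBounded_comp_clamp (hv : Continuous (Function.uncurry v))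
    (hVv : ∀ t y, HasDerivAt (V t) (v t y) y) :
    LipschitzOnBounded fun t y => V t (clamp y) := fun T _ => by
  obtain ⟨M, hM⟩ := exists_abs_comp_clamp_sub_le hv hVv T
  exact ⟨M, fun t ht => LipschitzOnWith.of_dist_le_mul fun y _ z _ => hM t ht y z⟩

theorem IsClampedField.exists_isFlow (hV : IsClampedField V v w) : ∃ U φ, IsFlow V v U φ := by
  obtain ⟨U, hUc, hU0, hU⟩ := exists_logJac hV.continuous_deriv hV.continuous_deriv₂
    hV.hasDerivAt_deriv
  set φ : ℝ → ℝ → ℝ := fun t x => ∫ y in (0 : ℝ)..x, Real.exp (U t y) with hφ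
  have htime (t : ℝ) {x : ℝ} (hx : x ∈ Icc (0 : ℝ) 1) :
      HasDerivAt (fun s => φ s x) (V t (clamp (φ t x))) t :=
    hV.hasDerivAt_time_integral_exp hUc hU t hx
  have hφ0 (x : ℝ) : φ 0 x = x := by simp [hφ, hU0]
  have hleft (t : ℝ) : φ t 0 = 0 := intervalIntegral.integral_same
  have hunique (f : ℝ → ℝ) (hf : IsIntegralCurve f V) (hmem : ∀ t, f t ∈ Icc (0 : ℝ) 1) (t : ℝ) :
      φ t (f 0) = f t :=
    congrFun ((lipschitzOnBounded_comp_clamp hV.continuous_deriv hV.hasDerivAt).integralCurve_unique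
      (f := fun t => φ t (f 0)) (fun t => htime t (hmem 0))
      (fun t => by simpa only [clamp_of_mem (hmem t)] using hf t) (hφ0 _)) t
  have hright : ∀ t, φ t 1 = 1 := hunique (fun _ => 1)
    (fun t => (hasDerivAt_const t 1).congr_deriv (hV.right t).symm)
    fun _ => right_mem_Icc.2 zero_le_one
  have hmono (t : ℝ) : Monotone (φ t) :=
    monotone_of_hasDerivAt_nonneg (hasDerivAt_integral_exp hUc t) fun x => (Real.exp_pos _).le
  have hmem (t x : ℝ) (hx : x ∈ Icc (0 : ℝ) 1) : φ t x ∈ Icc (0 : ℝ) 1 :=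
    ⟨(hleft t).symm.le.trans (hmono t hx.1), (hmono t hx.2).trans (hright t).le⟩
  exact ⟨U, φ,
    { continuous_logJac := hUc
      continuous_map := continuous_uncurry_integral_exp hUc
      logJac_zero := hU0
      map_zero := hφ0
      map_left := hleft
      map_right := hright
      hasDerivAt_space := hasDerivAt_integral_exp hUc
      hasDerivAt_logJac := fun t x hx => by
        simpa only [φ, clamp_of_mem (hmem t x hx)] using hU t x hx
      hasDerivAt_map := fun t x hx => by simpa only [clamp_of_mem (hmem t x hx)] using htime t hx
      unique := hunique }⟩

end Flow

/-! ### The coordinates of a flow -/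

section Coordinates

theorem intervalIntegral_congr_of_ae_leb01 {f g : ℝ → ℝ} (h : f =ᵐ[leb01] g) {x y : ℝ}
    (hx : x ∈ Icc (0 : ℝ) 1) (hy : y ∈ Icc (0 : ℝ) 1) :
    ∫ s in x..y, f s = ∫ s in x..y, g s := by
  refine intervalIntegral.integral_congr_ae ?_
  filter_upwards [(ae_restrict_iff' measurableSet_Icc).1 h] with s hs hmem
  exact hs (uIcc_subset_Icc hx hy (uIoc_subset_uIcc hmem))

theorem integral_congr_of_ae_leb01 {f g : ℝ → ℝ} (h : f =ᵐ[leb01] g) :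
    ∫ s in (0 : ℝ)..1, f s = ∫ s in (0 : ℝ)..1, g s :=
  intervalIntegral_congr_of_ae_leb01 h (left_mem_Icc.2 zero_le_one) (right_mem_Icc.2 zero_le_one)

/-- The time derivative, at the label `x`, of the coordinate `log ∂ₓφ` of a flow, differentiated in
`x`. -/
def flowCoordRate (w U φ : ℝ → ℝ → ℝ) (t x : ℝ) : ℝ := Real.exp (U t x) * w t (φ t x)

/-- The coordinate `∂ₓ log ∂ₓφ` of a flow `φ` with logarithmic Jacobian `U`, obtained by integrating
its time derivative because `U` is not known to be differentiable in space. -/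
def flowCoord (w U φ : ℝ → ℝ → ℝ) (t x : ℝ) : ℝ := ∫ s in (0 : ℝ)..t, flowCoordRate w U φ s x

/-- The curve in `Q` traced by a flow. -/
def flowQ (w U φ : ℝ → ℝ → ℝ) (t : ℝ) : L2 := toL2 (flowCoord w U φ t)

/-- The curve of covectors of a flow, over `flowQ`. -/
def flowP (w φ : ℝ → ℝ → ℝ) (t : ℝ) : L2 := toL2 fun x => w t (φ t x)

variable {V v w U φ : ℝ → ℝ → ℝ}

namespace IsClampedField

variable (h : IsClampedField V v w)
include h

theorem integral_deriv₂ (t : ℝ) : ∫ y in (0 : ℝ)..1, w t y = 0 := by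
  rw [intervalIntegral.integral_eq_sub_of_hasDerivAt (fun y _ => h.hasDerivAt_deriv t y)
    ((continuous_of_continuous_uncurry h.continuous_deriv₂ t).intervalIntegrable _ _),
    h.deriv_left, h.deriv_right, sub_zero]

theorem integral_deriv₂_mul_id (t : ℝ) : ∫ y in (0 : ℝ)..1, w t y * y = 0 := by
  have hw := continuous_of_continuous_uncurry h.continuous_deriv₂ t
  rw [intervalIntegral.integral_eq_sub_of_hasDerivAt (f := fun y => v t y * y - V t y)
    (fun y _ => (((h.hasDerivAt_deriv t y).fun_mul (hasDerivAt_id' y)).fun_sub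
      (h.hasDerivAt t y)).congr_deriv (by ring))
    ((hw.fun_mul continuous_id').intervalIntegrable _ _)]
  simp only [h.left, h.right, h.deriv_left, h.deriv_right, zero_mul, sub_zero]

theorem integral_deriv_mul_deriv₂ (t : ℝ) : ∫ y in (0 : ℝ)..1, v t y * w t y = 0 := by
  have hv := continuous_of_continuous_uncurry h.continuous_deriv t
  have hw := continuous_of_continuous_uncurry h.continuous_deriv₂ t
  rw [intervalIntegral.integral_eq_sub_of_hasDerivAt (f := fun y => v t y ^ 2 / 2)
    (fun y _ => (((h.hasDerivAt_deriv t y).fun_pow 2).div_const 2).congr_deriv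
      (by push_cast; ring)) ((hv.fun_mul hw).intervalIntegrable _ _)]
  simp only [h.deriv_left, h.deriv_right, sub_self]

theorem integral_deriv_mul_deriv₂_mul_id_add (t : ℝ) :
    ∫ y in (0 : ℝ)..1, (v t y * w t y * y + w t y * V t y) =
      -(3 / 2) * ∫ y in (0 : ℝ)..1, v t y ^ 2 := by
  have hV := continuous_of_continuous_uncurry h.continuous t
  have hv := continuous_of_continuous_uncurry h.continuous_deriv t
  have hw := continuous_of_continuous_uncurry h.continuous_deriv₂ t
  have hderiv (y : ℝ) : HasDerivAt (fun y => v t y ^ 2 / 2 * y + v t y * V t y)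
      (v t y * w t y * y + w t y * V t y - -(3 / 2) * v t y ^ 2) y :=
    (((((h.hasDerivAt_deriv t y).fun_pow 2).div_const 2).fun_mul (hasDerivAt_id' y)).fun_add
      ((h.hasDerivAt_deriv t y).fun_mul (h.hasDerivAt t y))).congr_deriv (by push_cast; ring)
  rw [← intervalIntegral.integral_const_mul, ← sub_eq_zero, ← intervalIntegral.integral_sub
    (Continuous.intervalIntegrable (by fun_prop) _ _)
    (Continuous.intervalIntegrable (by fun_prop) _ _),
    intervalIntegral.integral_eq_sub_of_hasDerivAt (fun y _ => hderiv y)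
      (Continuous.intervalIntegrable (by fun_prop) _ _)]
  simp [h.deriv_left, h.deriv_right]

end IsClampedField

namespace IsFlow

section

variable (h : IsFlow V v U φ)
include h

theorem monotone_map (t : ℝ) : Monotone (φ t) :=
  monotone_of_hasDerivAt_nonneg (h.hasDerivAt_space t) fun _ => (Real.exp_pos _).le

theorem continuous_comp_map {F : ℝ → ℝ → ℝ} (hF : Continuous (Function.uncurry F)) :
    Continuous (Function.uncurry fun t x => F t (φ t x)) :=
  hF.comp (continuous_fst.prodMk h.continuous_map)

theorem continuous_exp_logJac : Continuous (Function.uncurry fun t x => Real.exp (U t x)) :=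
  Real.continuous_exp.comp h.continuous_logJac

theorem integral_exp_mul_comp_map {F : ℝ → ℝ} (hF : Continuous F) (t x y : ℝ) :
    ∫ s in x..y, Real.exp (U t s) * F (φ t s) = ∫ z in φ t x..φ t y, F z := by
  simp_rw [mul_comm (Real.exp _)]
  exact intervalIntegral.integral_comp_mul_deriv (fun s _ => h.hasDerivAt_space t s)
    (continuous_of_continuous_uncurry h.continuous_exp_logJac t).continuousOn hF

theorem integral_exp_mul_comp_map_zero_one {F : ℝ → ℝ} (hF : Continuous F) (t : ℝ) :
    ∫ s in (0 : ℝ)..1, Real.exp (U t s) * F (φ t s) = ∫ z in (0 : ℝ)..1, F z := by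
  rw [h.integral_exp_mul_comp_map hF, h.map_left, h.map_right]

end

variable (hV : IsClampedField V v w) (h : IsFlow V v U φ)
include hV h

theorem logJac_right (t : ℝ) : U t 1 = 0 := by
  have hderiv (t : ℝ) : HasDerivAt (fun t => U t 1) 0 t :=
    (h.hasDerivAt_logJac t 1 (right_mem_Icc.2 zero_le_one)).congr_deriv
      (by rw [h.map_right, hV.deriv_right])
  rw [is_const_of_deriv_eq_zero (fun y => (hderiv y).differentiableAt)
    (fun y => (hderiv y).deriv) t 0, h.logJac_zero]

theorem continuous_flowCoordRate : Continuous (Function.uncurry (flowCoordRate w U φ)) :=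
  h.continuous_exp_logJac.mul (h.continuous_comp_map hV.continuous_deriv₂)

theorem continuous_flowCoord : Continuous (Function.uncurry (flowCoord w U φ)) :=
  intervalIntegral.continuous_parametric_intervalIntegral_of_continuous
    (f := fun (p : ℝ × ℝ) s => flowCoordRate w U φ s p.2) (s := fun p => p.1)
    ((h.continuous_flowCoordRate hV).comp
      (continuous_snd.prodMk (continuous_snd.comp continuous_fst))) continuous_fst

theorem hasDerivAt_flowCoord (t x : ℝ) :
    HasDerivAt (fun s => flowCoord w U φ s x) (flowCoordRate w U φ t x) t :=
  (((h.continuous_flowCoordRate hV).comp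
    (continuous_id.prodMk continuous_const)).integral_hasStrictDerivAt 0 t).hasDerivAt

theorem integral_flowCoordRate (t x : ℝ) :
    ∫ s in (0 : ℝ)..x, flowCoordRate w U φ t s = v t (φ t x) := by
  have hw := continuous_of_continuous_uncurry hV.continuous_deriv₂ t
  simp only [flowCoordRate]
  rw [h.integral_exp_mul_comp_map hw, h.map_left, intervalIntegral.integral_eq_sub_of_hasDerivAt
    (fun y _ => hV.hasDerivAt_deriv t y) (hw.intervalIntegrable _ _), hV.deriv_left, sub_zero]

theorem integral_flowCoord (t : ℝ) {x : ℝ} (hx : x ∈ Icc (0 : ℝ) 1) :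
    ∫ s in (0 : ℝ)..x, flowCoord w U φ t s = U t x := by
  have hderiv (t : ℝ) :
      HasDerivAt (fun t => (∫ s in (0 : ℝ)..x, flowCoord w U φ t s) - U t x) 0 t :=
    ((hasDerivAt_intervalIntegral (h.continuous_flowCoord hV) (h.continuous_flowCoordRate hV) hx.1
      (fun t y _ => h.hasDerivAt_flowCoord hV t y) t).fun_sub
        (h.hasDerivAt_logJac t x hx)).congr_deriv (by rw [h.integral_flowCoordRate hV, sub_self])
  have hconst := is_const_of_deriv_eq_zero (fun y => (hderiv y).differentiableAt)
    (fun y => (hderiv y).deriv) t 0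
  simp only [flowCoord, intervalIntegral.integral_same, h.logJac_zero,
    intervalIntegral.integral_zero, sub_zero] at hconst
  exact sub_eq_zero.1 hconst

theorem coeFn_flowQ (t : ℝ) : flowQ w U φ t =ᵐ[leb01] flowCoord w U φ t :=
  coeFn_toL2 (continuous_of_continuous_uncurry (h.continuous_flowCoord hV) t)

theorem coeFn_flowP (t : ℝ) : flowP w φ t =ᵐ[leb01] fun x => w t (φ t x) :=
  coeFn_toL2 (continuous_of_continuous_uncurry (h.continuous_comp_map hV.continuous_deriv₂) t)

theorem eta_flowQ (t : ℝ) {x : ℝ} (hx : x ∈ Icc (0 : ℝ) 1) :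
    eta (flowQ w U φ t) x = Real.exp (U t x) := by
  rw [eta, intervalIntegral_congr_of_ae_leb01 (h.coeFn_flowQ hV t) (left_mem_Icc.2 zero_le_one) hx,
    h.integral_flowCoord hV t hx]

theorem phi_flowQ (t : ℝ) {x : ℝ} (hx : x ∈ Icc (0 : ℝ) 1) : phi (flowQ w U φ t) x = φ t x := by
  rw [phi, intervalIntegral_congr_of_ae_leb01
    (ae_leb01_of_forall fun s hs => h.eta_flowQ hV t hs) (left_mem_Icc.2 zero_le_one) hx,
    intervalIntegral.integral_eq_sub_of_hasDerivAt (fun s _ => h.hasDerivAt_space t s)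
    ((continuous_of_continuous_uncurry h.continuous_exp_logJac t).intervalIntegrable _ _),
    h.map_left, sub_zero]

theorem flowQ_mem_Q (t : ℝ) : flowQ w U φ t ∈ Q := by
  have h1 : (1 : ℝ) ∈ Icc (0 : ℝ) 1 := right_mem_Icc.2 zero_le_one
  refine ⟨?_, (h.phi_flowQ hV t h1).trans (h.map_right t)⟩
  rw [integral_congr_of_ae_leb01 (h.coeFn_flowQ hV t), h.integral_flowCoord hV t h1,
    h.logJac_right hV]

theorem innerEta_flowQ (t : ℝ) {f g F G : ℝ → ℝ} (hf : f =ᵐ[leb01] F ∘ φ t)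
    (hg : ∀ x ∈ Icc (0 : ℝ) 1, g x = G (φ t x)) (hF : Continuous F) (hG : Continuous G) :
    innerEta (flowQ w U φ t) f g = ∫ y in (0 : ℝ)..1, F y * G y := by
  rw [← h.integral_exp_mul_comp_map_zero_one (hF.fun_mul hG) t]
  refine integral_congr_of_ae_leb01 ?_
  filter_upwards [hf, ae_leb01_of_forall fun x hx => h.eta_flowQ hV t hx,
    ae_leb01_of_forall hg] with x hfx hηx hgx
  rw [hfx, hηx, hgx, Function.comp_apply, mul_assoc]

theorem flowP_mem_cotangent (t : ℝ) : flowP w φ t ∈ cotangent (flowQ w U φ t) := by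
  have hw := continuous_of_continuous_uncurry hV.continuous_deriv₂ t
  constructor
  · rw [h.innerEta_flowQ hV t (h.coeFn_flowP hV t) (G := fun _ => 1) (fun _ _ => rfl) hw
      continuous_const]
    simpa only [mul_one] using hV.integral_deriv₂ t
  · rw [h.innerEta_flowQ hV t (h.coeFn_flowP hV t) (G := fun y => y)
      (fun x hx => h.phi_flowQ hV t hx) hw continuous_id, hV.integral_deriv₂_mul_id]

theorem hasDerivAt_flowQ (t : ℝ) :
    HasDerivAt (flowQ w U φ) (toL2 (flowCoordRate w U φ t)) t :=
  hasDerivAt_toL2 (h.continuous_flowCoord hV) (h.continuous_flowCoordRate hV)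
    (fun t x _ => h.hasDerivAt_flowCoord hV t x) t

theorem coeFn_flowCoordRate (t : ℝ) : ∀ᵐ x ∂leb01,
    toL2 (flowCoordRate w U φ t) x = eta (flowQ w U φ t) x * flowP w φ t x := by
  filter_upwards [coeFn_toL2 (continuous_of_continuous_uncurry (h.continuous_flowCoordRate hV) t),
    h.coeFn_flowP hV t, ae_leb01_of_forall fun x hx => h.eta_flowQ hV t hx] with x hrate hp hη
  rw [hrate, hp, hη, flowCoordRate]

theorem flowQ_zero : flowQ w U φ 0 = 0 := by
  refine Lp.ext ?_
  filter_upwards [h.coeFn_flowQ hV 0, Lp.coeFn_zero ℝ 2 leb01] with x hq hzero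
  rw [hq, hzero, flowCoord, intervalIntegral.integral_same, Pi.zero_apply]

end IsFlow

end Coordinates

/-! ### Geodesic flows -/

section GeodesicFlow

/-- A geodesic of `Q` defined for all times, in strong form: the base curve is `C²` and the momentum
differentiable. -/
structure IsCompleteGeodesic (p q : ℝ → L2) : Prop where
  contDiff : ContDiff ℝ 2 q
  differentiable : Differentiable ℝ p
  mem_Q : ∀ t, q t ∈ Q
  mem_cotangent : ∀ t, p t ∈ cotangent (q t)
  velocity : ∀ t, ∀ᵐ x ∂leb01, deriv q t x = eta (q t) x * p t x
  momentum : ∀ t, ∀ᵐ x ∂leb01, accelFlat (p t) (q t) (deriv p t) x = 0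

theorem IsCompleteGeodesic.isGeodesic {p q : ℝ → L2} (h : IsCompleteGeodesic p q) :
    IsGeodesic p q where
  mem_Q t _ := h.mem_Q t
  mem_cotangent t _ := h.mem_cotangent t
  velocity t _ :=
    ⟨_, (hasDerivAt_of_contDiff_two h.contDiff t).hasDerivWithinAt, h.velocity t⟩
  momentum t _ := ⟨_, (h.differentiable t).hasDerivAt.hasDerivWithinAt, h.momentum t⟩

/-- A flow `φ` of a clamped field `V` which is a geodesic. The field `momentum` is the momentum
equation in the Eulerian variable `y = φ t x`, where `w = V''` and `S` stand for `p` and `ṗ`; the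
right-hand side `c + d y` corresponds to `π₁ + π₂`, its coefficients being determined by the
constraints on `p`. -/
structure IsGeodesicFlow (V v w S U φ : ℝ → ℝ → ℝ) : Prop where
  field : IsClampedField V v w
  flow : IsFlow V v U φ
  continuous_rate : Continuous (Function.uncurry S)
  hasDerivAt_rate : ∀ t, ∀ x ∈ Icc (0 : ℝ) 1,
    HasDerivAt (fun s => w s (φ s x)) (S t (φ t x)) t
  momentum : ∀ t, ∃ c d, ∀ y, S t y + (1 / 2) * ∫ z in y..1, w t z ^ 2 = c + d * y

variable {V v w S U φ : ℝ → ℝ → ℝ}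

theorem IsFlow.hasDerivAt_integral (hV : IsClampedField V v w) (h : IsFlow V v U φ)
    {G G' : ℝ → ℝ → ℝ} (hG : Continuous (Function.uncurry G))
    (hG' : Continuous (Function.uncurry G'))
    (hGG' : ∀ t, ∀ x ∈ Icc (0 : ℝ) 1, HasDerivAt (fun s => G s (φ s x)) (G' t (φ t x)) t) (t : ℝ) :
    HasDerivAt (fun t => ∫ y in (0 : ℝ)..1, G t y)
      (∫ y in (0 : ℝ)..1, (v t y * G t y + G' t y)) t := by
  have hrate : Continuous (Function.uncurry fun t y => v t y * G t y + G' t y) :=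
    (hV.continuous_deriv.mul hG).add hG'
  have hderiv := hasDerivAt_intervalIntegral (f := fun t x => Real.exp (U t x) * G t (φ t x))
    (f' := fun t x => Real.exp (U t x) * (v t (φ t x) * G t (φ t x) + G' t (φ t x)))
    (h.continuous_exp_logJac.mul (h.continuous_comp_map hG))
    (h.continuous_exp_logJac.mul (h.continuous_comp_map hrate)) zero_le_one
    (fun t x hx => ((h.hasDerivAt_logJac t x hx).exp.fun_mul (hGG' t x hx)).congr_deriv
      (by ring)) t
  simpa only [h.integral_exp_mul_comp_map_zero_one (continuous_of_continuous_uncurry hG _),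
    h.integral_exp_mul_comp_map_zero_one (continuous_of_continuous_uncurry hrate _)] using hderiv

theorem IsFlow.integral_eta_mul_flowP (hV : IsClampedField V v w) (h : IsFlow V v U φ) (t : ℝ)
    {x : ℝ} (hx : x ∈ Icc (0 : ℝ) 1) :
    ∫ y in (0 : ℝ)..x, eta (flowQ w U φ t) y * flowP w φ t y = v t (φ t x) := by
  rw [← h.integral_flowCoordRate hV t x]
  refine intervalIntegral_congr_of_ae_leb01 ?_ (left_mem_Icc.2 zero_le_one) hx
  filter_upwards [h.coeFn_flowP hV t, ae_leb01_of_forall fun x hx => h.eta_flowQ hV t hx]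
    with y hp hη
  rw [hp, hη, flowCoordRate]

theorem IsFlow.coeffB_flow (hV : IsClampedField V v w) (h : IsFlow V v U φ) (t : ℝ) :
    coeffB (flowP w φ t) (flowQ w U φ t) = (3 / 2) * ∫ y in (0 : ℝ)..1, v t y ^ 2 := by
  rw [coeffB, ← h.integral_exp_mul_comp_map_zero_one
    ((continuous_of_continuous_uncurry hV.continuous_deriv t).fun_pow 2) t]
  congr 1
  refine integral_congr_of_ae_leb01 (ae_leb01_of_forall fun x hx => ?_)
  simp only [h.eta_flowQ hV t hx, h.integral_eta_mul_flowP hV t hx]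

theorem IsFlow.opU_flowP_sq (hV : IsClampedField V v w) (h : IsFlow V v U φ) (t : ℝ) {x : ℝ}
    (hx : x ∈ Icc (0 : ℝ) 1) : opU (fun y => flowP w φ t y ^ 2) (flowQ w U φ t) x =
      (1 / 2) * ∫ y in φ t x..1, w t y ^ 2 := by
  have hw := (continuous_of_continuous_uncurry hV.continuous_deriv₂ t).fun_pow 2
  have hcomp := h.integral_exp_mul_comp_map hw t x 1
  rw [h.map_right] at hcomp
  rw [opU, ← hcomp]
  congr 1
  refine intervalIntegral_congr_of_ae_leb01 ?_ hx (right_mem_Icc.2 zero_le_one)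
  filter_upwards [h.coeFn_flowP hV t, ae_leb01_of_forall fun x hx => h.eta_flowQ hV t hx]
    with y hp hη
  rw [hp, hη]

namespace IsGeodesicFlow

variable (h : IsGeodesicFlow V v w S U φ)
include h

theorem integral_rate (t : ℝ) : ∫ y in (0 : ℝ)..1, S t y = 0 := by
  have hv := continuous_of_continuous_uncurry h.field.continuous_deriv t
  have hw := continuous_of_continuous_uncurry h.field.continuous_deriv₂ t
  have hS := continuous_of_continuous_uncurry h.continuous_rate t
  have hderiv := h.flow.hasDerivAt_integral h.field h.field.continuous_deriv₂ h.continuous_rate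
    h.hasDerivAt_rate t
  simp only [h.field.integral_deriv₂] at hderiv
  have hzero := (hasDerivAt_const t (0 : ℝ)).unique hderiv
  rwa [intervalIntegral.integral_add ((hv.fun_mul hw).intervalIntegrable _ _)
    (hS.intervalIntegrable _ _), h.field.integral_deriv_mul_deriv₂, zero_add, eq_comm] at hzero

theorem integral_rate_mul_id (t : ℝ) :
    ∫ y in (0 : ℝ)..1, S t y * y = (3 / 2) * ∫ y in (0 : ℝ)..1, v t y ^ 2 := by
  have hV := continuous_of_continuous_uncurry h.field.continuous t
  have hv := continuous_of_continuous_uncurry h.field.continuous_deriv t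
  have hw := continuous_of_continuous_uncurry h.field.continuous_deriv₂ t
  have hS := continuous_of_continuous_uncurry h.continuous_rate t
  have hderiv := h.flow.hasDerivAt_integral h.field (G := fun t y => w t y * y)
    (G' := fun t y => S t y * y + w t y * V t y)
    (h.field.continuous_deriv₂.mul continuous_snd)
    ((h.continuous_rate.mul continuous_snd).add
      (h.field.continuous_deriv₂.mul h.field.continuous))
    (fun t x hx => (h.hasDerivAt_rate t x hx).fun_mul (h.flow.hasDerivAt_map t x hx)) t
  simp only [h.field.integral_deriv₂_mul_id] at hderiv
  have hzero := (hasDerivAt_const t (0 : ℝ)).unique hderiv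
  have hsplit : ∫ y in (0 : ℝ)..1, (v t y * (w t y * y) + (S t y * y + w t y * V t y)) =
      (∫ y in (0 : ℝ)..1, (v t y * w t y * y + w t y * V t y)) +
        ∫ y in (0 : ℝ)..1, S t y * y := by
    rw [← intervalIntegral.integral_add (Continuous.intervalIntegrable (by fun_prop) _ _)
      (Continuous.intervalIntegrable (by fun_prop) _ _)]
    exact intervalIntegral.integral_congr fun y _ => by ring
  rw [hsplit, h.field.integral_deriv_mul_deriv₂_mul_id_add] at hzero
  linarith

theorem exists_opU_flowP_sq (t : ℝ) : ∃ c d, ∀ x ∈ Icc (0 : ℝ) 1,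
    opU (fun y => flowP w φ t y ^ 2) (flowQ w U φ t) x = c + d * φ t x - S t (φ t x) := by
  obtain ⟨c, d, hcd⟩ := h.momentum t
  exact ⟨c, d, fun x hx => by rw [h.flow.opU_flowP_sq h.field t hx, ← hcd]; ring⟩

theorem integral_affine_sub_rate (c d t : ℝ) :
    ∫ y in (0 : ℝ)..1, (c + d * y - S t y) = c + d / 2 := by
  have hS := continuous_of_continuous_uncurry h.continuous_rate t
  have haffine : ∫ y in (0 : ℝ)..1, (c + d * y) = c + d / 2 := by
    rw [intervalIntegral.integral_eq_sub_of_hasDerivAt (f := fun y => c * y + d * y ^ 2 / 2)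
      (fun y _ => (((hasDerivAt_id' y).const_mul c).fun_add
        (((hasDerivAt_pow 2 y).const_mul d).div_const 2)).congr_deriv (by push_cast; ring))
      (Continuous.intervalIntegrable (by fun_prop) _ _)]
    ring
  rw [intervalIntegral.integral_sub (Continuous.intervalIntegrable (by fun_prop) _ _)
    (hS.intervalIntegrable _ _), haffine, h.integral_rate, sub_zero]

theorem integral_affine_sub_rate_mul_id (c d t : ℝ) :
    ∫ y in (0 : ℝ)..1, (c + d * y - S t y) * y =
      c / 2 + d / 3 - (3 / 2) * ∫ y in (0 : ℝ)..1, v t y ^ 2 := by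
  have hS := continuous_of_continuous_uncurry h.continuous_rate t
  have haffine : ∫ y in (0 : ℝ)..1, (c + d * y) * y = c / 2 + d / 3 := by
    rw [intervalIntegral.integral_eq_sub_of_hasDerivAt (f := fun y => c * y ^ 2 / 2 + d * y ^ 3 / 3)
      (fun y _ => ((((hasDerivAt_pow 2 y).const_mul c).div_const 2).fun_add
        (((hasDerivAt_pow 3 y).const_mul d).div_const 3)).congr_deriv (by push_cast; ring))
      (Continuous.intervalIntegrable (by fun_prop) _ _)]
    ring
  simp only [sub_mul]
  rw [intervalIntegral.integral_sub (Continuous.intervalIntegrable (by fun_prop) _ _)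
    (Continuous.intervalIntegrable (by fun_prop) _ _), haffine, h.integral_rate_mul_id]

theorem accelFlat_eq_zero (t : ℝ) {r : L2} (hr : r =ᵐ[leb01] fun x => S t (φ t x)) :
    ∀ᵐ x ∂leb01, accelFlat (flowP w φ t) (flowQ w U φ t) r x = 0 := by
  obtain ⟨c, d, hopU⟩ := h.exists_opU_flowP_sq t
  have hS := continuous_of_continuous_uncurry h.continuous_rate t
  have hF : Continuous fun y => c + d * y - S t y := by fun_prop
  have hone := h.flow.innerEta_flowQ h.field t (ae_leb01_of_forall hopU) (G := fun _ => 1)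
    (fun _ _ => rfl) hF continuous_const
  have hphi := h.flow.innerEta_flowQ h.field t (ae_leb01_of_forall hopU) (G := fun y => y)
    (fun x hx => h.flow.phi_flowQ h.field t hx) hF continuous_id
  simp only [mul_one, h.integral_affine_sub_rate] at hone
  rw [h.integral_affine_sub_rate_mul_id] at hphi
  filter_upwards [hr, ae_leb01_of_forall hopU,
    ae_leb01_of_forall fun x hx => h.flow.phi_flowQ h.field t hx] with x hrx hopUx hphix
  simp only [accelFlat, pi1, pi2, projStar, gramComb_eq, hone, hphi, h.flow.coeffB_flow h.field,
    hrx, hopUx, hphix]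
  ring

theorem hasDerivAt_flowP (t : ℝ) :
    HasDerivAt (flowP w φ) (toL2 fun x => S t (φ t x)) t :=
  hasDerivAt_toL2 (h.flow.continuous_comp_map h.field.continuous_deriv₂)
    (h.flow.continuous_comp_map h.continuous_rate) h.hasDerivAt_rate t

theorem contDiff_flowQ : ContDiff ℝ 2 (flowQ w U φ) := by
  have hrate : Continuous (Function.uncurry fun t y => v t y * w t y + S t y) :=
    (h.field.continuous_deriv.mul h.field.continuous_deriv₂).add h.continuous_rate
  have hdd : Continuous (Function.uncurry fun t x =>
      Real.exp (U t x) * (v t (φ t x) * w t (φ t x) + S t (φ t x))) :=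
    h.flow.continuous_exp_logJac.mul (h.flow.continuous_comp_map hrate)
  have hderiv : deriv (flowQ w U φ) = fun t => toL2 (flowCoordRate w U φ t) :=
    funext fun t => (h.flow.hasDerivAt_flowQ h.field t).deriv
  have hderiv₂ (t : ℝ) : HasDerivAt (deriv (flowQ w U φ))
      (toL2 fun x => Real.exp (U t x) * (v t (φ t x) * w t (φ t x) + S t (φ t x))) t :=
    hderiv ▸ hasDerivAt_toL2 (h.flow.continuous_flowCoordRate h.field) hdd
      (fun t x hx => ((h.flow.hasDerivAt_logJac t x hx).exp.fun_mul
        (h.hasDerivAt_rate t x hx)).congr_deriv (by ring)) t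
  refine contDiff_succ_iff_deriv.2 ⟨fun t => (h.flow.hasDerivAt_flowQ h.field t).differentiableAt,
    by simp, contDiff_one_iff_deriv.2 ⟨fun t => (hderiv₂ t).differentiableAt, ?_⟩⟩
  rw [funext fun t => (hderiv₂ t).deriv]
  exact continuous_toL2 hdd

theorem isCompleteGeodesic : IsCompleteGeodesic (flowP w φ) (flowQ w U φ) where
  contDiff := h.contDiff_flowQ
  differentiable t := (h.hasDerivAt_flowP t).differentiableAt
  mem_Q := h.flow.flowQ_mem_Q h.field
  mem_cotangent := h.flow.flowP_mem_cotangent h.field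
  velocity t := by
    rw [(h.flow.hasDerivAt_flowQ h.field t).deriv]
    exact h.flow.coeFn_flowCoordRate h.field t
  momentum t := by
    rw [(h.hasDerivAt_flowP t).deriv]
    exact h.accelFlat_eq_zero t (coeFn_toL2
      (continuous_of_continuous_uncurry (h.flow.continuous_comp_map h.continuous_rate) t))

end IsGeodesicFlow

end GeodesicFlow

/-! ### The geodesic of two landmarks -/

section LandmarkGeodesic

section Continuity

variable {X : Type*} [TopologicalSpace X] {a k y : X → ℝ} (ha : Continuous a) (hk : Continuous k)
  (hlt : ∀ z, a z < 1 / 2)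
include ha hk hlt

@[fun_prop]
theorem continuous_landmarkMomentum_comp : Continuous fun z => landmarkMomentum (a z) (k z) :=
  (continuous_const.mul hk).div (continuous_const.mul (continuous_const.sub ha))
    fun z => mul_ne_zero two_ne_zero (sub_ne_zero.2 (hlt z).ne')

variable (hy : Continuous y)
include hy

@[fun_prop]
theorem continuous_landmarkField_comp : Continuous fun z => landmarkField (a z) (k z) (y z) := by
  simp only [landmarkField, quadCoeff, cubicCoeff]
  fun_prop (disch := exact hlt)

@[fun_prop]
theorem continuous_landmarkFieldDeriv_comp :
    Continuous fun z => landmarkFieldDeriv (a z) (k z) (y z) := by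
  simp only [landmarkFieldDeriv, quadCoeff, cubicCoeff]
  fun_prop (disch := exact hlt)

theorem continuous_landmarkFieldDeriv₂_comp :
    Continuous fun z => landmarkFieldDeriv₂ (a z) (k z) (y z) := by
  simp only [landmarkFieldDeriv₂, quadCoeff, cubicCoeff]
  fun_prop (disch := exact hlt)

theorem continuous_materialDeriv_comp : Continuous fun z => materialDeriv (a z) (k z) (y z) := by
  simp only [materialDeriv, quadCoeffRate, cubicCoeffRate, strengthRate, landmarkVelocity,
    cubicCoeff]
  fun_prop (disch := exact hlt)

end Continuity

namespace IsTrajectory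

variable {a k : ℝ → ℝ} (h : IsTrajectory a k)
include h

theorem continuous_position : Continuous a :=
  continuous_iff_continuousAt.2 fun t => (h.hasDerivAt_position t).continuousAt

theorem continuous_strength : Continuous k :=
  continuous_iff_continuousAt.2 fun t => (h.hasDerivAt_strength t).continuousAt

theorem isClampedField : IsClampedField (fun t => landmarkField (a t) (k t))
    (fun t => landmarkFieldDeriv (a t) (k t)) (fun t => landmarkFieldDeriv₂ (a t) (k t)) where
  continuous := continuous_landmarkField_comp (h.continuous_position.comp continuous_fst)
    (h.continuous_strength.comp continuous_fst) (fun _ => h.lt_half _) continuous_snd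
  continuous_deriv := continuous_landmarkFieldDeriv_comp (h.continuous_position.comp continuous_fst)
    (h.continuous_strength.comp continuous_fst) (fun _ => h.lt_half _) continuous_snd
  continuous_deriv₂ := continuous_landmarkFieldDeriv₂_comp
    (h.continuous_position.comp continuous_fst) (h.continuous_strength.comp continuous_fst)
    (fun _ => h.lt_half _) continuous_snd
  hasDerivAt t := hasDerivAt_landmarkField (a t) (k t)
  hasDerivAt_deriv t := hasDerivAt_landmarkFieldDeriv (a t) (k t)
  left t := landmarkField_zero (h.pos t) (h.lt_half t)
  right t := landmarkField_one (h.pos t) (h.lt_half t)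
  deriv_left t := landmarkFieldDeriv_zero (h.pos t) (h.lt_half t)
  deriv_right t := landmarkFieldDeriv_one (h.pos t) (h.lt_half t)

theorem hasDerivAt_quadCoeff (t : ℝ) :
    HasDerivAt (fun t => quadCoeff (a t) (k t)) (quadCoeffRate (a t) (k t)) t :=
  ((((h.hasDerivAt_strength t).const_mul (3 / 2)).fun_mul (h.hasDerivAt_position t)).fun_mul
    ((h.hasDerivAt_position t).const_sub 1)).congr_deriv (by rw [quadCoeffRate]; ring)

theorem hasDerivAt_cubicCoeff (t : ℝ) :
    HasDerivAt (fun t => cubicCoeff (a t) (k t)) (cubicCoeffRate (a t) (k t)) t :=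
  ((h.hasDerivAt_strength t).fun_mul (((h.hasDerivAt_position t).const_add (1 / 2)).fun_sub
    ((h.hasDerivAt_position t).fun_pow 2))).congr_deriv
      (by rw [cubicCoeffRate]; push_cast; ring)

theorem hasDerivAt_momentum (t : ℝ) : HasDerivAt (fun t => landmarkMomentum (a t) (k t))
    (-(landmarkMomentum (a t) (k t) * landmarkFieldDeriv (a t) (k t) (a t))) t := by
  have hne : 1 / 2 - a t ≠ 0 := sub_ne_zero.2 (h.lt_half t).ne'
  refine (((h.hasDerivAt_strength t).const_mul 3).fun_div
    (((h.hasDerivAt_position t).const_sub (1 / 2)).const_mul 2)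
    (mul_ne_zero two_ne_zero hne)).congr_deriv ?_
  rw [landmarkFieldDeriv_left (h.lt_half t), landmarkMomentum, strengthRate, landmarkVelocity]
  field_simp
  ring

end IsTrajectory

/-- The flow of two landmarks whose positions and strengths follow the trajectory `a`, `k`. -/
abbrev IsLandmarkFlow (a k : ℝ → ℝ) (U φ : ℝ → ℝ → ℝ) : Prop :=
  IsFlow (fun t => landmarkField (a t) (k t)) (fun t => landmarkFieldDeriv (a t) (k t)) U φ

namespace IsLandmarkFlow

variable {a k : ℝ → ℝ} {U φ : ℝ → ℝ → ℝ} (hF : IsLandmarkFlow a k U φ) (h : IsTrajectory a k)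
include hF h

theorem map_left_landmark (t : ℝ) : φ t (1 / 4) = a t :=
  h.position_zero ▸ hF.unique a
    (fun t => (h.hasDerivAt_position t).congr_deriv (landmarkField_left (h.lt_half t)).symm)
    (fun t => ⟨(h.pos t).le, by linarith [h.lt_half t]⟩) t

theorem map_right_landmark (t : ℝ) : φ t (3 / 4) = 1 - a t := by
  have hunique := hF.unique (fun t => 1 - a t)
    (fun t => ((h.hasDerivAt_position t).const_sub 1).congr_deriv
      (landmarkField_right (h.lt_half t)).symm)
    (fun t => ⟨by linarith [h.lt_half t], by linarith [h.pos t]⟩) t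
  rwa [h.position_zero, show (1 : ℝ) - 1 / 4 = 3 / 4 by norm_num] at hunique

theorem map_half (t : ℝ) : φ t (1 / 2) = 1 / 2 :=
  hF.unique (fun _ => 1 / 2)
    (fun t => (hasDerivAt_const t _).congr_deriv (landmarkField_half (h.lt_half t)).symm)
    (fun _ => ⟨by norm_num, by norm_num⟩) t

omit h in
theorem hasDerivAt_max_map {x₀ : ℝ} (hx₀ : x₀ ∈ Icc (0 : ℝ) 1) {b : ℝ → ℝ}
    (hb : ∀ t, φ t x₀ = b t) (t : ℝ) {x : ℝ} (hx : x ∈ Icc (0 : ℝ) 1) :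
    HasDerivAt (fun t => max (φ t x) (b t) - b t)
      (landmarkField (a t) (k t) (max (φ t x) (b t)) - landmarkField (a t) (k t) (b t)) t := by
  have hmem : max x x₀ ∈ Icc (0 : ℝ) 1 := ⟨hx.1.trans (le_max_left _ _), max_le hx.2 hx₀.2⟩
  simpa only [(hF.monotone_map _).map_max, hb] using
    (hF.hasDerivAt_map t _ hmem).fun_sub (hF.hasDerivAt_map t x₀ hx₀)

theorem hasDerivAt_landmarkFieldDeriv₂_map (t : ℝ) {x : ℝ} (hx : x ∈ Icc (0 : ℝ) 1) :
    HasDerivAt (fun t => landmarkFieldDeriv₂ (a t) (k t) (φ t x))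
      (materialDeriv (a t) (k t) (φ t x)) t := by
  have hleft := hF.hasDerivAt_max_map ⟨by norm_num, by norm_num⟩ (hF.map_left_landmark h) t hx
  have hright := hF.hasDerivAt_max_map ⟨by norm_num, by norm_num⟩ (hF.map_right_landmark h) t hx
  refine (((((h.hasDerivAt_quadCoeff t).const_mul 2).fun_sub
    (((h.hasDerivAt_cubicCoeff t).const_mul 6).fun_mul (hF.hasDerivAt_map t x hx))).fun_add
    ((h.hasDerivAt_momentum t).fun_mul hleft)).fun_sub
    ((h.hasDerivAt_momentum t).fun_mul hright)).congr_deriv ?_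
  rw [materialDeriv, landmarkFieldDeriv_left (h.lt_half t), landmarkFieldDeriv_right (h.lt_half t)]
  ring

theorem isGeodesicFlow : IsGeodesicFlow (fun t => landmarkField (a t) (k t))
    (fun t => landmarkFieldDeriv (a t) (k t)) (fun t => landmarkFieldDeriv₂ (a t) (k t))
    (fun t => materialDeriv (a t) (k t)) U φ where
  field := h.isClampedField
  flow := hF
  continuous_rate := continuous_materialDeriv_comp (h.continuous_position.comp continuous_fst)
    (h.continuous_strength.comp continuous_fst) (fun _ => h.lt_half _) continuous_snd
  hasDerivAt_rate t _ hx := hF.hasDerivAt_landmarkFieldDeriv₂_map h t hx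
  momentum t := exists_affine_materialDeriv (h.lt_half t)

end IsLandmarkFlow

section TestFunction

variable {g : ℝ → ℝ} (hg : ContDiff ℝ 2 g) (hg₁ : g 1 = 0) (hg₁' : deriv g 1 = 0)
include hg hg₁ hg₁'

theorem integral_max_sub_mul_deriv_deriv {b : ℝ} (hb : b ∈ Icc (0 : ℝ) 1) :
    ∫ x in (0 : ℝ)..1, (max x b - b) * deriv (deriv g) x = g b := by
  have hcont := continuous_deriv_deriv_of_contDiff_two hg
  have hderiv (x : ℝ) : HasDerivAt (fun x => (x - b) * deriv g x - g x)
      ((x - b) * deriv (deriv g) x) x :=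
    ((((hasDerivAt_id' x).sub_const b).fun_mul (hasDerivAt_deriv_of_contDiff_two hg x)).fun_sub
      (hasDerivAt_of_contDiff_two hg x)).congr_deriv (by ring)
  have hkink (x : ℝ) : HasDerivAt (fun x => (max x b - b) * deriv g (max x b) - g (max x b))
      ((max x b - b) * deriv (deriv g) x) x := by
    refine (hasDerivAt_comp_max hderiv (by ring) x).congr_deriv ?_
    rcases le_total x b with hxb | hxb
    · simp only [max_eq_right hxb, sub_self, zero_mul]
    · simp only [max_eq_left hxb]
  rw [intervalIntegral.integral_eq_sub_of_hasDerivAt (fun x _ => hkink x)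
    ((Continuous.fun_mul (by fun_prop) hcont).intervalIntegrable _ _)]
  simp only [max_eq_left hb.2, max_eq_right hb.1, hg₁, hg₁']
  ring

theorem integral_affine_mul_deriv_deriv (hg₀ : g 0 = 0) (hg₀' : deriv g 0 = 0) (c d : ℝ) :
    ∫ x in (0 : ℝ)..1, (c + d * x) * deriv (deriv g) x = 0 := by
  have hcont := continuous_deriv_deriv_of_contDiff_two hg
  rw [intervalIntegral.integral_eq_sub_of_hasDerivAt
    (f := fun x => (c + d * x) * deriv g x - d * g x)
    (fun x _ => (((((hasDerivAt_id' x).const_mul d).const_add c).fun_mul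
      (hasDerivAt_deriv_of_contDiff_two hg x)).fun_sub
      ((hasDerivAt_of_contDiff_two hg x).const_mul d)).congr_deriv (by ring))
    ((Continuous.fun_mul (by fun_prop) hcont).intervalIntegrable _ _)]
  simp only [hg₀, hg₀', hg₁, hg₁']
  ring

end TestFunction

namespace IsLandmarkFlow

variable {a k : ℝ → ℝ} {U φ : ℝ → ℝ → ℝ} (hF : IsLandmarkFlow a k U φ) (h : IsTrajectory a k)
include hF h

theorem coeFn_flowP_zero :
    flowP (fun t => landmarkFieldDeriv₂ (a t) (k t)) φ 0 =ᵐ[leb01] fun x =>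
      2 * quadCoeff (1 / 4) (1 / 6) + -6 * cubicCoeff (1 / 4) (1 / 6) * x +
        ((max x (1 / 4) - 1 / 4) - (max x (3 / 4) - 3 / 4)) := by
  filter_upwards [hF.coeFn_flowP h.isClampedField 0] with x hx
  rw [hx, hF.map_zero, h.position_zero, h.strength_zero, landmarkFieldDeriv₂,
    show landmarkMomentum (1 / 4) (1 / 6) = 1 by norm_num [landmarkMomentum],
    show (1 : ℝ) - 1 / 4 = 3 / 4 by norm_num]
  ring

theorem integral_flowP_zero_mul {g : ℝ → ℝ} (hg : ContDiff ℝ 2 g) (hg₀ : g 0 = 0) (hg₁ : g 1 = 0)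
    (hg₀' : deriv g 0 = 0) (hg₁' : deriv g 1 = 0) :
    ∫ x in (0 : ℝ)..1, flowP (fun t => landmarkFieldDeriv₂ (a t) (k t)) φ 0 x *
      deriv (deriv g) x = g (1 / 4) - g (3 / 4) := by
  have hcont := continuous_deriv_deriv_of_contDiff_two hg
  have hae := (hF.coeFn_flowP_zero h).fun_mul (ae_eq_refl (deriv (deriv g)))
  have hint {f : ℝ → ℝ} (hf : Continuous f) :
      IntervalIntegrable (fun x => f x * deriv (deriv g) x) volume 0 1 :=
    (hf.mul hcont).intervalIntegrable _ _
  rw [integral_congr_of_ae_leb01 hae]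
  simp_rw [add_mul _ (_ - _), sub_mul (max _ _ - _)]
  rw [intervalIntegral.integral_add (hint (by fun_prop))
      ((hint (by fun_prop)).sub (hint (by fun_prop))),
    intervalIntegral.integral_sub (hint (by fun_prop)) (hint (by fun_prop)),
    integral_affine_mul_deriv_deriv hg hg₁ hg₁' hg₀ hg₀',
    integral_max_sub_mul_deriv_deriv hg hg₁ hg₁' ⟨by norm_num, by norm_num⟩,
    integral_max_sub_mul_deriv_deriv hg hg₁ hg₁' ⟨by norm_num, by norm_num⟩, zero_add]

theorem isLandmarkGeodesic : IsLandmarkGeodesic ![1, -1] ![1 / 4, 3 / 4]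
    (flowP (fun t => landmarkFieldDeriv₂ (a t) (k t)) φ)
    (flowQ (fun t => landmarkFieldDeriv₂ (a t) (k t)) U φ) where
  geodesic := (hF.isGeodesicFlow h).isCompleteGeodesic.isGeodesic
  start := hF.flowQ_zero h.isClampedField
  start_momentum := by
    refine ⟨hF.flowQ_zero h.isClampedField ▸ hF.flowP_mem_cotangent h.isClampedField 0,
      fun g hg hg₀ hg₁ hg₀' hg₁' => ?_⟩
    rw [hF.integral_flowP_zero_mul h hg hg₀ hg₁ hg₀' hg₁', Fin.sum_univ_two]
    simp [sub_eq_add_neg]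

theorem hasDerivAt_logJac_half (t : ℝ) :
    HasDerivAt (fun t => U t (1 / 2)) (-(3 / 4) * (k t * a t ^ 2)) t :=
  (hF.hasDerivAt_logJac t (1 / 2) ⟨by norm_num, by norm_num⟩).congr_deriv
    (by rw [hF.map_half h, landmarkFieldDeriv_half (h.lt_half t), mul_assoc])

theorem logJac_half_sub_le {c : ℝ} (hc : ∀ t, 0 ≤ t → c ≤ k t * a t ^ 2) {s t : ℝ} (hs : 0 ≤ s)
    (hst : s ≤ t) : U t (1 / 2) - U s (1 / 2) ≤ -(3 / 4 * c) * (t - s) :=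
  (convex_Ici (0 : ℝ)).image_sub_le_mul_sub_of_deriv_le
    (fun t _ => (hF.hasDerivAt_logJac_half h t).continuousAt.continuousWithinAt)
    (fun t _ => (hF.hasDerivAt_logJac_half h t).differentiableAt.differentiableWithinAt)
    (fun t ht => by
      rw [(hF.hasDerivAt_logJac_half h t).deriv]
      linarith [hc t (interior_subset ht)]) s hs t (hs.trans hst) hst

theorem strictAntiOn_logJac_half {c : ℝ} (hc0 : 0 < c) (hc : ∀ t, 0 ≤ t → c ≤ k t * a t ^ 2) :
    StrictAntiOn (fun t => U t (1 / 2)) (Ici 0) := fun s hs t _ hst => by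
  have hpos := mul_pos hc0 (sub_pos.2 hst)
  linarith [hF.logJac_half_sub_le h hc hs hst.le]

theorem logJac_half_le {c : ℝ} (hc : ∀ t, 0 ≤ t → c ≤ k t * a t ^ 2) {t : ℝ} (ht : 0 ≤ t) :
    U t (1 / 2) ≤ -(3 / 4 * c * t) := by
  have hle := hF.logJac_half_sub_le h hc le_rfl ht
  rw [hF.logJac_zero] at hle
  linarith

end IsLandmarkFlow

end LandmarkGeodesic

/-! ### The inner product of covectors -/

section InnerEta

variable {q : L2} {f f' g : ℝ → ℝ} {x : ℝ}

theorem integral_leb01 (f : ℝ → ℝ) : ∫ x, f x ∂leb01 = ∫ x in (0 : ℝ)..1, f x := by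
  rw [intervalIntegral.integral_of_le zero_le_one, integral_Icc_eq_integral_Ioc]

theorem intervalIntegral_eq_setIntegral_leb01 (f : ℝ → ℝ) (hx : x ∈ Icc (0 : ℝ) 1) :
    ∫ s in (0 : ℝ)..x, f s = ∫ s in Iic x, f s ∂leb01 := by
  have h : Iic x ∩ Icc 0 1 = Icc 0 x := by
    ext s
    exact ⟨fun hs => ⟨hs.2.1, hs.1⟩, fun hs => ⟨hs.2, hs.1, hs.2.trans hx.2⟩⟩
  rw [intervalIntegral.integral_of_le hx.1, ← integral_Icc_eq_integral_Ioc,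
    Measure.restrict_restrict measurableSet_Iic, h]

theorem lintegral_ofReal_leb01 (hf : Integrable f leb01) (h0 : ∀ᵐ x ∂leb01, 0 ≤ f x) :
    ∫⁻ x in Icc (0 : ℝ) 1, ENNReal.ofReal (f x) = ENNReal.ofReal (∫ x in (0 : ℝ)..1, f x) := by
  rw [← integral_leb01, ofReal_integral_eq_lintegral_ofReal hf h0]

theorem continuousOn_eta (q : L2) : ContinuousOn (eta q) (Icc 0 1) := by
  have hq : IntegrableOn q (uIcc 0 1) := by
    rw [uIcc_of_le zero_le_one]
    exact (Lp.memLp q).integrable one_le_two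
  rw [← uIcc_of_le (zero_le_one' ℝ)]
  exact (intervalIntegral.continuousOn_primitive_interval hq).rexp

theorem eta_pos (q : L2) (x : ℝ) : 0 < eta q x := Real.exp_pos _

theorem intervalIntegrable_eta (q : L2) (hx : x ∈ Icc (0 : ℝ) 1) :
    IntervalIntegrable (eta q) volume 0 x :=
  ((continuousOn_eta q).mono (Icc_subset_Icc_right hx.2)).intervalIntegrable_of_Icc hx.1

theorem hasDerivAt_phi (q : L2) (hx : x ∈ Ioo (0 : ℝ) 1) : HasDerivAt (phi q) (eta q x) x :=
  intervalIntegral.integral_hasDerivAt_right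
    (intervalIntegrable_eta q (Ioo_subset_Icc_self hx))
    (((continuousOn_eta q).mono Ioo_subset_Icc_self).stronglyMeasurableAtFilter isOpen_Ioo x hx)
    ((continuousOn_eta q).continuousAt (Icc_mem_nhds hx.1 hx.2))

theorem continuousOn_phi (q : L2) : ContinuousOn (phi q) (Icc 0 1) := by
  have hη : IntegrableOn (eta q) (uIcc 0 1) := by
    rw [uIcc_of_le zero_le_one]
    exact (continuousOn_eta q).integrableOn_Icc
  rw [← uIcc_of_le (zero_le_one' ℝ)]
  exact intervalIntegral.continuousOn_primitive_interval hη

theorem phi_le_one (hq : q ∈ Q) (hx : x ∈ Icc (0 : ℝ) 1) : phi q x ≤ 1 := by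
  rw [phi, ← hq.2]
  exact intervalIntegral.integral_mono_interval le_rfl hx.1 hx.2
    (ae_of_all _ fun y => (eta_pos q y).le) (intervalIntegrable_eta q (right_mem_Icc.2 zero_le_one))

theorem memLp_phi (q : L2) : MemLp (phi q) 2 leb01 := memLp_of_continuousOn (continuousOn_phi q)

theorem memLp_gramComb (q : L2) (a b : ℝ) : MemLp (gramComb q a b) 2 leb01 := by
  rw [funext (gramComb_eq q a b)]
  exact (memLp_const (4 * a - 6 * b)).add ((memLp_phi q).const_mul (12 * b - 6 * a))

theorem memLp_projStar (q : L2) (hf : MemLp f 2 leb01) : MemLp (projStar q f) 2 leb01 :=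
  hf.sub (memLp_gramComb q _ _)

theorem integrable_eta_mul_mul (q : L2) (hf : MemLp f 2 leb01) (hg : MemLp g 2 leb01) :
    Integrable (fun x => eta q x * f x * g x) leb01 := by
  obtain ⟨M, hM⟩ := isCompact_Icc.exists_bound_of_continuousOn (continuousOn_eta q)
  simp only [mul_assoc]
  exact (hf.integrable_mul hg).bdd_mul
    ((continuousOn_eta q).aestronglyMeasurable_of_isCompact isCompact_Icc measurableSet_Icc)
    (ae_leb01_of_forall hM)

theorem innerEta_comm (q : L2) (f g : ℝ → ℝ) : innerEta q f g = innerEta q g f := by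
  simp only [innerEta, mul_right_comm]

theorem innerEta_congr (hf : f =ᵐ[leb01] f') (g : ℝ → ℝ) : innerEta q f g = innerEta q f' g := by
  refine integral_congr_of_ae_leb01 ?_
  filter_upwards [hf] with x hx
  rw [hx]

theorem innerEta_const_mul (q : L2) (c : ℝ) (f g : ℝ → ℝ) :
    innerEta q (fun x => c * f x) g = c * innerEta q f g := by
  rw [innerEta, innerEta, ← intervalIntegral.integral_const_mul]
  exact intervalIntegral.integral_congr fun x _ => by ring

theorem innerEta_add (q : L2) (hf : MemLp f 2 leb01) (hf' : MemLp f' 2 leb01)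
    (hg : MemLp g 2 leb01) :
    innerEta q (fun x => f x + f' x) g = innerEta q f g + innerEta q f' g := by
  rw [innerEta, innerEta, innerEta, ← integral_leb01, ← integral_leb01, ← integral_leb01,
    ← integral_add (integrable_eta_mul_mul q hf hg) (integrable_eta_mul_mul q hf' hg)]
  simp only [mul_add, add_mul]

theorem innerEta_self_nonneg (q : L2) (f : ℝ → ℝ) : 0 ≤ innerEta q f f :=
  intervalIntegral.integral_nonneg zero_le_one fun x _ => by
    rw [mul_assoc]
    exact mul_nonneg (eta_pos q x).le (mul_self_nonneg _)

theorem innerEta_indicator_Iic (q : L2) (f : ℝ → ℝ) (hx : x ∈ Icc (0 : ℝ) 1) :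
    innerEta q f ((Iic x).indicator 1) = ∫ y in (0 : ℝ)..x, eta q y * f y := by
  have h (y : ℝ) : eta q y * f y * (Iic x).indicator 1 y =
      (Iic x).indicator (fun y => eta q y * f y) y := by
    by_cases hy : y ∈ Iic x
    · rw [indicator_of_mem hy, indicator_of_mem hy, Pi.one_apply, mul_one]
    · rw [indicator_of_notMem hy, indicator_of_notMem hy, mul_zero]
  simp only [innerEta, h]
  rw [← integral_leb01, integral_indicator measurableSet_Iic,
    intervalIntegral_eq_setIntegral_leb01 _ hx]

theorem memLp_indicator_Iic (x : ℝ) : MemLp ((Iic x).indicator (1 : ℝ → ℝ)) 2 leb01 :=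
  (memLp_const 1).indicator measurableSet_Iic

theorem innerEta_indicator_Iic_self_le (hq : q ∈ Q) (hx : x ∈ Icc (0 : ℝ) 1) :
    innerEta q ((Iic x).indicator 1) ((Iic x).indicator 1) ≤ 1 := by
  refine le_trans (le_of_eq ?_) (phi_le_one hq hx)
  rw [innerEta_indicator_Iic q _ hx, phi]
  refine intervalIntegral.integral_congr fun y hy => ?_
  rw [uIcc_of_le hx.1] at hy
  rw [indicator_of_mem (show y ∈ Iic x from hy.2), Pi.one_apply, mul_one]

theorem lintegral_eta_mul_sq (q : L2) (hf : MemLp f 2 leb01) :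
    ∫⁻ x in Icc (0 : ℝ) 1, ENNReal.ofReal (eta q x * f x ^ 2) =
      ENNReal.ofReal (innerEta q f f) := by
  have h : Integrable (fun x => eta q x * f x ^ 2) leb01 := by
    simpa only [pow_two, mul_assoc] using integrable_eta_mul_mul q hf hf
  rw [lintegral_ofReal_leb01 h (ae_of_all _ fun x => mul_nonneg (eta_pos q x).le (sq_nonneg _))]
  simp only [innerEta, pow_two, mul_assoc]

end InnerEta

section Projection

variable {q : L2} {f g : ℝ → ℝ}

theorem phi_zero (q : L2) : phi q 0 = 0 := intervalIntegral.integral_same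

theorem integral_eta_mul_phi_pow (hq : q ∈ Q) (n : ℕ) :
    ∫ x in (0 : ℝ)..1, eta q x * phi q x ^ n = 1 / (n + 1) := by
  have hn : (n + 1 : ℝ) ≠ 0 := by positivity
  rw [intervalIntegral.integral_eq_sub_of_hasDerivAt_of_le zero_le_one
    (f := fun x => phi q x ^ (n + 1) / (n + 1))
    (((continuousOn_phi q).fun_pow _).div_const _) (fun x hx => ?_)
    (ContinuousOn.intervalIntegrable_of_Icc zero_le_one
      ((continuousOn_eta q).fun_mul ((continuousOn_phi q).fun_pow n))),
    phi_zero, show phi q 1 = 1 from hq.2]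
  · simp
  · refine (((hasDerivAt_phi q hx).fun_pow (n + 1)).div_const _).congr_deriv ?_
    rw [Nat.add_sub_cancel]
    push_cast
    field_simp

theorem innerEta_one_one (hq : q ∈ Q) : innerEta q (fun _ => 1) (fun _ => 1) = 1 := by
  simpa [innerEta] using integral_eta_mul_phi_pow hq 0

theorem innerEta_phi_one (hq : q ∈ Q) : innerEta q (phi q) (fun _ => 1) = 1 / 2 := by
  have := integral_eta_mul_phi_pow hq 1
  norm_num at this
  simpa [innerEta] using this

theorem innerEta_phi_phi (hq : q ∈ Q) : innerEta q (phi q) (phi q) = 1 / 3 := by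
  have := integral_eta_mul_phi_pow hq 2
  norm_num at this
  simpa [innerEta, mul_assoc, pow_two] using this

theorem innerEta_gramComb (q : L2) (a b : ℝ) (hg : MemLp g 2 leb01) :
    innerEta q (gramComb q a b) g =
      (4 * a - 6 * b) * innerEta q (fun _ => 1) g + (12 * b - 6 * a) * innerEta q (phi q) g := by
  rw [← innerEta_const_mul, ← innerEta_const_mul,
    ← innerEta_add q ((memLp_const _).const_mul _) ((memLp_phi q).const_mul _) hg]
  simp only [mul_one, funext (gramComb_eq q a b)]

theorem eq_projStar_add_gramComb (q : L2) (f : ℝ → ℝ) :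
    f = fun x => projStar q f x +
      gramComb q (innerEta q f fun _ => 1) (innerEta q f (phi q)) x :=
  funext fun _ => (sub_add_cancel _ _).symm

theorem projStar_const_mul (q : L2) (c : ℝ) (f : ℝ → ℝ) (x : ℝ) :
    projStar q (fun y => c * f y) x = c * projStar q f x := by
  simp only [projStar, innerEta_const_mul, gramComb_eq]
  ring

theorem innerEta_projStar_add (q : L2) (hf : MemLp f 2 leb01) (hg : MemLp g 2 leb01) :
    innerEta q (projStar q f) g +
      innerEta q (gramComb q (innerEta q f fun _ => 1) (innerEta q f (phi q))) g =
      innerEta q f g := by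
  rw [← innerEta_add q (memLp_projStar q hf) (memLp_gramComb q _ _) hg,
    ← eq_projStar_add_gramComb]

theorem innerEta_projStar_one (hq : q ∈ Q) (hf : MemLp f 2 leb01) :
    innerEta q (projStar q f) (fun _ => 1) = 0 := by
  have h := innerEta_projStar_add q hf (memLp_const 1)
  rw [innerEta_gramComb q _ _ (memLp_const 1), innerEta_one_one hq, innerEta_phi_one hq] at h
  linarith

theorem innerEta_projStar_phi (hq : q ∈ Q) (hf : MemLp f 2 leb01) :
    innerEta q (projStar q f) (phi q) = 0 := by
  have h := innerEta_projStar_add q hf (memLp_phi q)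
  rw [innerEta_gramComb q _ _ (memLp_phi q), innerEta_comm q (fun _ => 1), innerEta_phi_one hq,
    innerEta_phi_phi hq] at h
  linarith

theorem innerEta_projStar_self_le (hq : q ∈ Q) (hf : MemLp f 2 leb01) :
    innerEta q (projStar q f) (projStar q f) ≤ innerEta q f f := by
  set a := innerEta q f fun _ => 1
  set b := innerEta q f (phi q)
  have hπ := memLp_projStar q hf
  have horth : innerEta q (gramComb q a b) (projStar q f) = 0 := by
    rw [innerEta_gramComb q _ _ hπ, innerEta_comm q (fun _ => 1), innerEta_comm q (phi q),
      innerEta_projStar_one hq hf, innerEta_projStar_phi hq hf, mul_zero, mul_zero, add_zero]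
  calc innerEta q (projStar q f) (projStar q f)
      ≤ innerEta q (projStar q f) (projStar q f) +
          innerEta q (gramComb q a b) (gramComb q a b) :=
        le_add_of_nonneg_right (innerEta_self_nonneg q _)
    _ = innerEta q f (projStar q f) + innerEta q f (gramComb q a b) := by
        rw [← innerEta_projStar_add q hf hπ, ← innerEta_projStar_add q hf (memLp_gramComb q _ _),
          horth, innerEta_comm q (projStar q f) (gramComb q a b), horth, add_zero, zero_add]
    _ = innerEta q f f := by
        rw [innerEta_comm q f, innerEta_comm q f, innerEta_projStar_add q hf hf]

theorem innerEta_projStar_of_mem_cotangent {p : L2} (hp : p ∈ cotangent q) (hf : MemLp f 2 leb01) :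
    innerEta q p (projStar q f) = innerEta q p f := by
  rw [innerEta_comm, innerEta_comm q p f, ← innerEta_projStar_add q hf (Lp.memLp p),
    innerEta_gramComb q _ _ (Lp.memLp p), innerEta_comm q (fun _ => 1) p, innerEta_comm q (phi q) p,
    hp.1, hp.2, mul_zero, mul_zero, add_zero, add_zero]

end Projection

/-! ### Reparametrized geodesics -/

section Scaling

variable (c : ℝ) (p q : L2)

theorem coeFn_smul_L2 : (c • p : L2) =ᵐ[leb01] fun x => c * p x := by
  filter_upwards [Lp.coeFn_smul c p] with x hx
  rw [hx, Pi.smul_apply, smul_eq_mul]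

theorem pi2_eq_gramComb (f : ℝ → ℝ) (x : ℝ) : pi2 q f x =
    gramComb q (innerEta q (opU f q) fun _ => 1) (innerEta q (opU f q) (phi q)) x := by
  rw [pi2, projStar, sub_sub_cancel]

theorem opU_smul_sq {x : ℝ} (hx : x ∈ Icc (0 : ℝ) 1) :
    opU (fun y => (c • p : L2) y ^ 2) q x = c ^ 2 * opU (fun y => p y ^ 2) q x := by
  rw [opU, opU, mul_left_comm, ← intervalIntegral.integral_const_mul (c ^ 2)]
  congr 1
  refine intervalIntegral_congr_of_ae_leb01 ?_ hx (right_mem_Icc.2 zero_le_one)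
  filter_upwards [coeFn_smul_L2 c p] with y hy
  rw [hy]
  ring

theorem coeffB_smul : coeffB (c • p) q = c ^ 2 * coeffB p q := by
  have hinner {x : ℝ} (hx : x ∈ Icc (0 : ℝ) 1) :
      ∫ y in (0 : ℝ)..x, eta q y * (c • p : L2) y = c * ∫ y in (0 : ℝ)..x, eta q y * p y := by
    rw [← intervalIntegral.integral_const_mul]
    refine intervalIntegral_congr_of_ae_leb01 ?_ (left_mem_Icc.2 zero_le_one) hx
    filter_upwards [coeFn_smul_L2 c p] with y hy
    rw [hy]
    ring
  rw [coeffB, coeffB, mul_left_comm, ← intervalIntegral.integral_const_mul (c ^ 2)]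
  congr 1
  refine integral_congr_of_ae_leb01 (ae_leb01_of_forall fun x hx => ?_)
  simp only [hinner hx]
  ring

theorem accelFlat_smul (r e : L2) : ∀ᵐ x ∂leb01,
    accelFlat (c • p) q (e + c • c • r) x = e x + c ^ 2 * accelFlat p q r x := by
  have hU : opU (fun y => (c • p : L2) y ^ 2) q =ᵐ[leb01]
      fun x => c ^ 2 * opU (fun y => p y ^ 2) q x :=
    ae_leb01_of_forall fun x hx => opU_smul_sq c p q hx
  filter_upwards [Lp.coeFn_add e (c • c • r), coeFn_smul_L2 c (c • r), coeFn_smul_L2 c r, hU]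
    with x hadd hsmul₂ hsmul hUx
  rw [accelFlat, accelFlat, hadd, Pi.add_apply, hsmul₂, hsmul, hUx, pi1, pi1, pi2_eq_gramComb,
    pi2_eq_gramComb, innerEta_congr hU, innerEta_congr hU, innerEta_const_mul, innerEta_const_mul,
    coeffB_smul]
  simp only [gramComb_eq]
  ring

variable {p q} in
theorem smul_mem_cotangent (hp : p ∈ cotangent q) : c • p ∈ cotangent q := by
  constructor
  · rw [innerEta_congr (coeFn_smul_L2 c p), innerEta_const_mul, hp.1, mul_zero]
  · rw [innerEta_congr (coeFn_smul_L2 c p), innerEta_const_mul, hp.2, mul_zero]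

end Scaling

section Reparam

theorem memH2_of_contDiff {u : ℝ → L2} (hu : ContDiff ℝ 2 u) : MemH2 u := by
  have hcont := continuous_deriv_deriv_of_contDiff_two hu
  refine ⟨deriv u, ⟨deriv (deriv u), memLp_of_continuousOn hcont.continuousOn, fun t _ => ?_⟩,
    fun t _ => (hasDerivAt_of_contDiff_two hu t).hasDerivWithinAt⟩
  rw [intervalIntegral.integral_eq_sub_of_hasDerivAt
    (fun s _ => hasDerivAt_deriv_of_contDiff_two hu s) (hcont.intervalIntegrable _ _),
    add_sub_cancel]

variable {p q : ℝ → L2} {α : ℝ → ℝ} (h : IsCompleteGeodesic p q) (hα : ContDiff ℝ 2 α)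
include h hα

theorem IsCompleteGeodesic.isCurve_reparam : IsCurve (deriv α 0 • p (α 0)) (q (α 0))
    (fun t => deriv α t • p (α t)) (fun t => q (α t)) where
  memH2 := memH2_of_contDiff (h.contDiff.comp hα)
  mem_Q t _ := h.mem_Q _
  mem_cotangent t _ := smul_mem_cotangent _ (h.mem_cotangent _)
  velocity t _ := by
    refine ⟨_, ((hasDerivAt_of_contDiff_two h.contDiff (α t)).scomp t
      (hasDerivAt_of_contDiff_two hα t)).hasDerivWithinAt, ?_⟩
    filter_upwards [h.velocity (α t), coeFn_smul_L2 (deriv α t) (deriv q (α t)),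
      coeFn_smul_L2 (deriv α t) (p (α t))] with x hvel hq hp
    rw [hq, hp, hvel]
    ring
  start_p := rfl
  start_q := rfl

theorem IsCompleteGeodesic.accelFlat_reparam (t : ℝ) : ∀ᵐ x ∂leb01,
    accelFlat (deriv α t • p (α t)) (q (α t)) (deriv (fun t => deriv α t • p (α t)) t) x =
      deriv (deriv α) t * p (α t) x := by
  have hderiv : HasDerivAt (fun t => deriv α t • p (α t))
      (deriv (deriv α) t • p (α t) + deriv α t • deriv α t • deriv p (α t)) t := by
    rw [add_comm]
    exact (hasDerivAt_deriv_of_contDiff_two hα t).smul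
      ((h.differentiable (α t)).hasDerivAt.scomp t (hasDerivAt_of_contDiff_two hα t))
  rw [hderiv.deriv]
  filter_upwards [accelFlat_smul (deriv α t) (p (α t)) (q (α t)) (deriv p (α t))
    (deriv (deriv α) t • p (α t)), h.momentum (α t),
    coeFn_smul_L2 (deriv (deriv α) t) (p (α t))] with x haccel hgeo hp
  rw [haccel, hgeo, hp, mul_zero, add_zero]

end Reparam

section Jacobian

theorem integral_eq_inner_indicator (q : L2) {y : ℝ} (hy : y ∈ Icc (0 : ℝ) 1) :
    ∫ s in (0 : ℝ)..y, q s = inner ℝ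
      (indicatorConstLp 2 (measurableSet_Iic (a := y)) (measure_ne_top leb01 _) (1 : ℝ)) q := by
  rw [intervalIntegral_eq_setIntegral_leb01 _ hy, L2.inner_indicatorConstLp_one]

theorem innerEta_eq_inner {q p u : L2} (hu : ∀ᵐ x ∂leb01, u x = eta q x * p x) (r : L2) :
    innerEta q p r = inner ℝ r u := by
  rw [innerEta, ← integral_leb01, L2.inner_def]
  refine integral_congr_ae ?_
  filter_upwards [hu] with x hx
  rw [hx]
  simp

variable {q : ℝ → L2} {y : ℝ} (hy : y ∈ Icc (0 : ℝ) 1)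
include hy

theorem hasDerivAt_eta {q' : L2} {t : ℝ} (hq : HasDerivAt q q' t) :
    HasDerivAt (fun t => eta (q t) y) (eta (q t) y * ∫ s in (0 : ℝ)..y, q' s) t := by
  simp only [eta, integral_eq_inner_indicator _ hy]
  simpa using (((hasDerivAt_const t _).inner ℝ hq).exp)

theorem continuous_integral_L2 (hq : Continuous q) :
    Continuous fun t => ∫ s in (0 : ℝ)..y, q t s := by
  simp only [integral_eq_inner_indicator _ hy]
  exact continuous_const.inner hq

theorem continuous_eta (hq : Continuous q) : Continuous fun t => eta (q t) y :=
  Real.continuous_exp.comp (continuous_integral_L2 hy hq)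

end Jacobian

namespace IsCompleteGeodesic

variable {p q : ℝ → L2} (h : IsCompleteGeodesic p q)
include h

theorem continuous_deriv : Continuous (deriv q) :=
  h.contDiff.continuous_deriv one_le_two

theorem continuous_innerEta_self : Continuous fun t => innerEta (q t) (p t) (p t) := by
  simp only [innerEta_eq_inner (h.velocity _)]
  exact h.differentiable.continuous.inner h.continuous_deriv

variable {y : ℝ} (hy : y ∈ Icc (0 : ℝ) 1)
include hy

theorem integral_deriv_eq_innerEta (t : ℝ) : ∫ s in (0 : ℝ)..y, deriv q t s =
    innerEta (q t) (p t) ((Iic y).indicator 1) := by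
  rw [innerEta_indicator_Iic _ _ hy]
  exact intervalIntegral_congr_of_ae_leb01 (h.velocity t) (left_mem_Icc.2 zero_le_one) hy

theorem hasDerivAt_eta (t : ℝ) : HasDerivAt (fun t => eta (q t) y)
    (eta (q t) y * innerEta (q t) (p t) ((Iic y).indicator 1)) t := by
  rw [← h.integral_deriv_eq_innerEta hy]
  exact DiffSpline.hasDerivAt_eta hy (hasDerivAt_of_contDiff_two h.contDiff t)

theorem continuous_deriv_eta : Continuous fun t =>
    eta (q t) y * innerEta (q t) (p t) ((Iic y).indicator 1) := by
  simp only [← h.integral_deriv_eq_innerEta hy]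
  exact (continuous_eta hy h.contDiff.continuous).mul (continuous_integral_L2 hy h.continuous_deriv)

end IsCompleteGeodesic

/-! ### The Fisher–Rao functional on absolutely continuous measures -/

section FisherRao

section SignedMeasure

variable {X : Type*} [MeasurableSpace X] (μ : Measure X) [IsFiniteMeasure μ]

theorem toJordanDecomposition_toSignedMeasure : μ.toSignedMeasure.toJordanDecomposition =
    ⟨μ, 0, Measure.MutuallySingular.zero_right⟩ :=
  SignedMeasure.toJordanDecomposition_eq (by simp [JordanDecomposition.toSignedMeasure])

theorem totalVariation_toSignedMeasure : μ.toSignedMeasure.totalVariation = μ := by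
  rw [SignedMeasure.totalVariation, toJordanDecomposition_toSignedMeasure, add_zero]

theorem rnDeriv_toSignedMeasure (ν : Measure X) :
    μ.toSignedMeasure.rnDeriv ν =ᵐ[ν] fun x => (μ.rnDeriv ν x).toReal := by
  filter_upwards [Measure.rnDeriv_zero ν] with x hx
  rw [SignedMeasure.rnDeriv, toJordanDecomposition_toSignedMeasure]
  simp [hx]

end SignedMeasure

theorem rnDeriv_withDensity_ofReal_div {X : Type*} [MeasurableSpace X] {σ : Measure X}
    [SigmaFinite σ] {u s : X → ℝ} (hu : Measurable u) (hs : Measurable s)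
    (hpos : ∀ᵐ x ∂σ, 0 < s x) :
    (σ.withDensity fun x => ENNReal.ofReal (u x)).rnDeriv
      (σ.withDensity fun x => ENNReal.ofReal (s x)) =ᵐ[σ] fun x => ENNReal.ofReal (u x / s x) := by
  filter_upwards [Measure.rnDeriv_withDensity_right
    (σ.withDensity fun x => ENNReal.ofReal (u x)) σ hs.ennreal_ofReal.aemeasurable
    (hpos.mono fun x hx => (ENNReal.ofReal_pos.2 hx).ne')
    (Eventually.of_forall fun _ => ENNReal.ofReal_ne_top),
    Measure.rnDeriv_withDensity σ hu.ennreal_ofReal, hpos] with x hright hdens hx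
  rw [hright, hdens, ENNReal.ofReal_div_of_pos hx, ENNReal.div_eq_inv_mul]

theorem frIntegrand_div {x y s : ℝ} (hx : 0 < x) (hs : 0 < s) :
    ENNReal.ofReal s * frIntegrand (x / s) (y / s) = ENNReal.ofReal (1 / 4 * (y ^ 2 / x)) := by
  rw [frIntegrand, if_pos (div_pos hx hs), ← ENNReal.ofReal_mul hs.le]
  congr 1
  field_simp

variable {σ : Measure (ℝ × ℝ)} [SigmaFinite σ] {u v : ℝ × ℝ → ℝ}

theorem fisherRao_withDensity (hu : Measurable u) (hv : Measurable v)
    (hu₀ : ∀ᵐ z ∂σ, 0 < u z) (hv₀ : ∀ᵐ z ∂σ, 0 ≤ v z)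
    [IsFiniteMeasure (σ.withDensity fun z => ENNReal.ofReal (v z))] (f : ℝ × ℝ → ℝ) :
    fisherRao f (σ.withDensity fun z => ENNReal.ofReal (u z))
        (σ.withDensity fun z => ENNReal.ofReal (v z)).toSignedMeasure =
      ∫⁻ z, ENNReal.ofReal (1 / 4 * (v z ^ 2 / u z)) * ENNReal.ofReal (f z) ∂σ := by
  have hsum : (σ.withDensity fun z => ENNReal.ofReal (u z)) +
      (σ.withDensity fun z => ENNReal.ofReal (v z)) =
      σ.withDensity fun z => ENNReal.ofReal (u z + v z) := by
    rw [← withDensity_add_left hu.ennreal_ofReal]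
    refine withDensity_congr_ae ?_
    filter_upwards [hu₀, hv₀] with z huz hvz using (ENNReal.ofReal_add huz.le hvz).symm
  have hpos : ∀ᵐ z ∂σ, 0 < u z + v z := by
    filter_upwards [hu₀, hv₀] with z huz hvz using add_pos_of_pos_of_nonneg huz hvz
  have hmeas : Measurable fun z => u z + v z := hu.add hv
  have hsigned := (withDensity_absolutelyContinuous' hmeas.ennreal_ofReal.aemeasurable
    (hpos.mono fun z hz => (ENNReal.ofReal_pos.2 hz).ne')).ae_le
    (rnDeriv_toSignedMeasure (σ.withDensity fun z => ENNReal.ofReal (v z))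
      (σ.withDensity fun z => ENNReal.ofReal (u z + v z)))
  rw [fisherRao, totalVariation_toSignedMeasure, hsum,
    lintegral_withDensity_eq_lintegral_mul_non_measurable₀ _
      hmeas.ennreal_ofReal.aemeasurable (Eventually.of_forall fun _ => ENNReal.ofReal_lt_top)]
  refine lintegral_congr_ae ?_
  filter_upwards [hsigned, rnDeriv_withDensity_ofReal_div hu hmeas hpos,
    rnDeriv_withDensity_ofReal_div hv hmeas hpos, hu₀, hv₀, hpos]
    with z hsz huz hvz hu₀z hv₀z hposz
  rw [Pi.mul_apply, ← mul_assoc, hsz, huz, hvz, ENNReal.toReal_ofReal (div_nonneg hu₀z.le hposz.le),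
    ENNReal.toReal_ofReal (div_nonneg hv₀z hposz.le), frIntegrand_div hu₀z hposz]

end FisherRao

/-! ### Measures carried by a line -/

section LineMeasure

/-- The measure `ρ(t) dt ⊗ δ_y`: a defect which at time `t` is a mass `ρ(t)` placed at `y`. -/
def lineMeas (y : ℝ) (ρ : ℝ → ℝ) : Measure (ℝ × ℝ) :=
  (leb01.withDensity fun t => ENNReal.ofReal (ρ t)).prod (Measure.dirac y)

variable {y : ℝ} {ρ ρ' : ℝ → ℝ}

theorem isFiniteMeasure_lineMeas (hρ : Integrable ρ leb01) : IsFiniteMeasure (lineMeas y ρ) :=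
  have := isFiniteMeasure_withDensity_ofReal hρ.2
  inferInstanceAs (IsFiniteMeasure (Measure.prod _ _))

theorem lineMeas_eq_withDensity (hρ : Measurable ρ) : lineMeas y ρ =
    (leb01.prod (Measure.dirac y)).withDensity fun z => ENNReal.ofReal (ρ z.1) :=
  prod_withDensity_left hρ.ennreal_ofReal

theorem measurableEmbedding_line (y : ℝ) : MeasurableEmbedding fun t : ℝ => (t, y) :=
  measurableEmbedding_prod_mk_right y

theorem ae_prod_dirac {p : ℝ × ℝ → Prop} (h : ∀ᵐ t ∂leb01, p (t, y)) :
    ∀ᵐ z ∂leb01.prod (Measure.dirac y), p z := by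
  rw [Measure.prod_dirac]
  exact (measurableEmbedding_line y).ae_map_iff.2 h

theorem lineMeas_compl_D (hρ : Measurable ρ) (hy : y ∈ Icc (0 : ℝ) 1) : lineMeas y ρ Dᶜ = 0 := by
  rw [lineMeas_eq_withDensity hρ]
  exact withDensity_absolutelyContinuous _ _
    (ae_prod_dirac (p := (· ∈ D)) (ae_leb01_of_forall fun t ht => ⟨ht, hy⟩))

theorem integral_lineMeas (hρ : Measurable ρ) (hρ₀ : ∀ t ∈ Icc (0 : ℝ) 1, 0 ≤ ρ t)
    (f : ℝ × ℝ → ℝ) : ∫ z, f z ∂lineMeas y ρ = ∫ t in (0 : ℝ)..1, ρ t * f (t, y) := by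
  rw [lineMeas, Measure.prod_dirac, (measurableEmbedding_line y).integral_map,
    integral_withDensity_eq_integral_toReal_smul hρ.ennreal_ofReal (by simp), integral_leb01]
  refine integral_congr_of_ae_leb01 (ae_leb01_of_forall fun t ht => ?_)
  simp only [ENNReal.toReal_ofReal (hρ₀ t ht), smul_eq_mul]

theorem isTimeDeriv_lineMeas (hy : y ∈ Icc (0 : ℝ) 1) (hρ : ∀ t, HasDerivAt ρ (ρ' t) t)
    (hρ' : Continuous ρ') (hρ₀ : ∀ t ∈ Icc (0 : ℝ) 1, 0 ≤ ρ t)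
    (hρ'₀ : ∀ t ∈ Icc (0 : ℝ) 1, 0 ≤ ρ' t) (hzero : ρ 0 = 0) [IsFiniteMeasure (lineMeas y ρ')] :
    IsTimeDeriv (lineMeas y ρ) (lineMeas y ρ').toSignedMeasure := by
  have hcont : Continuous ρ := continuous_iff_continuousAt.2 fun t => (hρ t).continuousAt
  have hmaps : MapsTo (fun t => (t, y)) (Icc 0 1) D := fun t ht => ⟨ht, hy⟩
  refine ⟨by rw [totalVariation_toSignedMeasure, lineMeas_compl_D hρ'.measurable hy],
    fun f ft hf hf₁ => ?_⟩
  have hfy : ContinuousOn (fun t => f (t, y)) (Icc 0 1) := hf.cont.comp (by fun_prop) hmaps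
  have hfty : ContinuousOn (fun t => ft (t, y)) (Icc 0 1) :=
    hf.cont_deriv.comp (by fun_prop) hmaps
  have hint : IntervalIntegrable (fun t => ρ t * ft (t, y)) volume 0 1 :=
    (hcont.continuousOn.mul hfty).intervalIntegrable_of_Icc zero_le_one
  have hint' : IntervalIntegrable (fun t => ρ' t * f (t, y)) volume 0 1 :=
    (hρ'.continuousOn.mul hfy).intervalIntegrable_of_Icc zero_le_one
  have hderiv : ∀ t ∈ Ioo (0 : ℝ) 1,
      HasDerivAt (fun t => ρ t * f (t, y)) (ρ t * ft (t, y) + ρ' t * f (t, y)) t := fun t ht =>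
    ((hρ t).fun_mul ((hf.hasDeriv t (Ioo_subset_Icc_self ht) y hy).hasDerivAt
      (Icc_mem_nhds ht.1 ht.2))).congr_deriv (add_comm _ _)
  rw [VectorMeasure.integral_toSignedMeasure, integral_lineMeas hcont.measurable hρ₀,
    integral_lineMeas hρ'.measurable hρ'₀, ← intervalIntegral.integral_add hint hint',
    intervalIntegral.integral_eq_sub_of_hasDerivAt_of_le (f := fun t => ρ t * f (t, y)) zero_le_one
      (hcont.continuousOn.mul hfy) hderiv (hint.add hint'), hzero, hf₁ y hy,
    mul_zero, zero_mul, sub_zero]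

theorem fisherRao_lineMeas (hρ : Measurable ρ) (hρ' : Measurable ρ')
    (hρ₀ : ∀ᵐ t ∂leb01, 0 < ρ t) (hρ'₀ : ∀ᵐ t ∂leb01, 0 ≤ ρ' t)
    [hfin : IsFiniteMeasure (lineMeas y ρ')] (f : ℝ × ℝ → ℝ) :
    fisherRao f (lineMeas y ρ) (lineMeas y ρ').toSignedMeasure =
      ∫⁻ t in Icc (0 : ℝ) 1, ENNReal.ofReal (1 / 4 * (ρ' t ^ 2 / ρ t)) *
        ENNReal.ofReal (f (t, y)) := by
  have : IsFiniteMeasure ((leb01.prod (Measure.dirac y)).withDensity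
      fun z => ENNReal.ofReal (ρ' z.1)) := lineMeas_eq_withDensity hρ' ▸ hfin
  simp only [lineMeas_eq_withDensity hρ, lineMeas_eq_withDensity hρ']
  rw [fisherRao_withDensity (u := fun z => ρ z.1) (v := fun z => ρ' z.1)
    (hρ.comp measurable_fst) (hρ'.comp measurable_fst)
    (ae_prod_dirac hρ₀) (ae_prod_dirac hρ'₀), Measure.prod_dirac,
    (measurableEmbedding_line y).lintegral_map]

theorem slice_lineMeas (hρ : Measurable ρ) {Δ : FiniteMeasure (ℝ × ℝ)}
    (hΔ : (Δ : Measure (ℝ × ℝ)) = lineMeas y ρ) :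
    ∀ᵐ t ∂leb01, slice Δ t = ENNReal.ofReal (ρ t) • Measure.dirac y := by
  have hfst : (Δ : Measure (ℝ × ℝ)).fst = leb01.withDensity fun t => ENNReal.ofReal (ρ t) := by
    rw [hΔ, lineMeas, Measure.fst_prod]
  have hmarginal : ∀ᵐ t ∂leb01,
      (Δ : Measure (ℝ × ℝ)).fst.rnDeriv volume t = ENNReal.ofReal (ρ t) := by
    rw [hfst, ← withDensity_indicator measurableSet_Icc]
    filter_upwards [ae_restrict_of_ae (Measure.rnDeriv_withDensity volume
      (hρ.ennreal_ofReal.indicator measurableSet_Icc)), ae_restrict_mem measurableSet_Icc]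
      with t ht hmem
    rw [ht, indicator_of_mem hmem]
  have hcond : (Δ : Measure (ℝ × ℝ)) = (Δ : Measure (ℝ × ℝ)).fst.compProd
      (ProbabilityTheory.Kernel.const ℝ (Measure.dirac y)) := by
    rw [hfst, Measure.compProd_const, hΔ, lineMeas]
  have hkernel := ProbabilityTheory.eq_condKernel_of_measure_eq_compProd _ hcond
  rw [hfst, ae_withDensity_iff hρ.ennreal_ofReal] at hkernel
  filter_upwards [hmarginal, hkernel] with t hmass hdirac
  rw [slice, hmass]
  by_cases hzero : ENNReal.ofReal (ρ t) = 0
  · rw [hzero, zero_smul, zero_smul]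
  · rw [← hdirac hzero, ProbabilityTheory.Kernel.const_apply]

theorem opUMeas_smul_dirac (q : L2) {c : ℝ} (hc : 0 ≤ c) (hy : y ≤ 1) (x : ℝ) :
    opUMeas (ENNReal.ofReal c • Measure.dirac y) q x =
      (1 / 2) * c * eta q y * (Iic y).indicator 1 x := by
  classical
  rw [opUMeas, Measure.restrict_smul, integral_smul_measure, setIntegral_dirac,
    ENNReal.toReal_ofReal hc, smul_eq_mul]
  by_cases hx : x ≤ y
  · rw [if_pos ⟨hx, hy⟩, indicator_of_mem (mem_Iic.2 hx), Pi.one_apply]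
    ring
  · rw [if_neg (fun h => hx h.1), indicator_of_notMem (notMem_Iic.2 (not_le.1 hx))]
    ring

end LineMeasure

/-! ### The relaxed energy of a defect carried by a line -/

section Quadratic

variable {q p : L2} {f : ℝ → ℝ}

theorem memLp_const_mul_add {g : ℝ → ℝ} (hf : MemLp f 2 leb01) (hg : MemLp g 2 leb01)
    (c κ : ℝ) : MemLp (fun x => c * f x + κ * g x) 2 leb01 :=
  (hf.const_mul c).add (hg.const_mul κ)

theorem innerEta_add_const_mul_self (hf : MemLp f 2 leb01) {g : ℝ → ℝ} (hg : MemLp g 2 leb01)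
    (c κ : ℝ) : innerEta q (fun x => c * f x + κ * g x) (fun x => c * f x + κ * g x) =
      c ^ 2 * innerEta q f f + 2 * c * κ * innerEta q f g + κ ^ 2 * innerEta q g g := by
  have hleft {k : ℝ → ℝ} (hk : MemLp k 2 leb01) :
      innerEta q (fun x => c * f x + κ * g x) k = c * innerEta q f k + κ * innerEta q g k := by
    rw [innerEta_add q (hf.const_mul c) (hg.const_mul κ) hk, innerEta_const_mul, innerEta_const_mul]
  rw [hleft (memLp_const_mul_add hf hg c κ), innerEta_comm q f, innerEta_comm q g,
    hleft hf, hleft hg, innerEta_comm q g f]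
  ring

theorem innerEta_add_projStar_self_le (hq : q ∈ Q) (hp : p ∈ cotangent q) (hf : MemLp f 2 leb01)
    (c κ : ℝ) :
    innerEta q (fun x => c * p x + κ * projStar q f x) (fun x => c * p x + κ * projStar q f x) ≤
      c ^ 2 * innerEta q p p + 2 * c * κ * innerEta q p f + κ ^ 2 * innerEta q f f := by
  rw [innerEta_add_const_mul_self (Lp.memLp p) (memLp_projStar q hf),
    innerEta_projStar_of_mem_cotangent hp hf]
  gcongr
  exact innerEta_projStar_self_le hq hf

theorem lintegral_eta_mul_add_projStar_opUMeas_sq {accel : ℝ → ℝ} {c g y : ℝ}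
    (haccel : ∀ᵐ x ∂leb01, accel x = c * p x) (hg : 0 ≤ g) (hy : y ≤ 1) :
    ∫⁻ x in Icc (0 : ℝ) 1, ENNReal.ofReal (eta q x *
        (accel x + projStar q (opUMeas (ENNReal.ofReal g • Measure.dirac y) q) x) ^ 2) =
      ENNReal.ofReal (innerEta q
        (fun x => c * p x + 1 / 2 * g * eta q y * projStar q ((Iic y).indicator 1) x)
        (fun x => c * p x + 1 / 2 * g * eta q y * projStar q ((Iic y).indicator 1) x)) := by
  have hπ := memLp_projStar q (memLp_indicator_Iic y)
  rw [← lintegral_eta_mul_sq q (memLp_const_mul_add (Lp.memLp p) hπ c _),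
    funext (opUMeas_smul_dirac q hg hy)]
  refine lintegral_congr_ae ?_
  filter_upwards [haccel] with x hx
  rw [hx, projStar_const_mul]

end Quadratic

/-- The second term of `relaxedF`: the squared norm of the relaxed acceleration. -/
def relaxedAccelEnergy (p q : ℝ → L2) (Δ : FiniteMeasure (ℝ × ℝ)) : ℝ≥0∞ :=
  ∫⁻ t in Icc (0 : ℝ) 1, ∫⁻ x in Icc (0 : ℝ) 1, ENNReal.ofReal (eta (q t) x *
    (accelFlat (p t) (q t) (deriv p t) x + projStar (q t) (opUMeas (slice Δ t) (q t)) x) ^ 2)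

section RelaxedF

variable {P : L2 → L2 → ℝ} {p q : ℝ → L2} {Δ : FiniteMeasure (ℝ × ℝ)} {a b : ℝ}

theorem relaxedF_le (ha : 0 ≤ a) (hb : 0 ≤ b) (hFR : fisherRaoPath q Δ ≤ ENNReal.ofReal a)
    (haccel : relaxedAccelEnergy p q Δ ≤ ENNReal.ofReal b) :
    relaxedF P p q Δ ≤ ((a + b + P (p 1) (q 1) : ℝ) : EReal) := by
  have hsum := (add_le_add hFR haccel).trans_eq (ENNReal.ofReal_add ha hb).symm
  rw [EReal.coe_add, ← max_eq_left (add_nonneg ha hb), ← EReal.coe_ennreal_ofReal]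
  exact add_le_add_left (EReal.coe_ennreal_le_coe_ennreal_iff.2 hsum) _

theorem le_relaxedF (haccel : ENNReal.ofReal b ≤ relaxedAccelEnergy p q Δ) :
    ((b + P (p 1) (q 1) : ℝ) : EReal) ≤ relaxedF P p q Δ := by
  have hb : (b : EReal) ≤ (ENNReal.ofReal b : EReal) := by
    rw [EReal.coe_ennreal_ofReal]
    exact EReal.coe_le_coe_iff.2 (le_max_left _ _)
  rw [EReal.coe_add]
  exact add_le_add_left (hb.trans (EReal.coe_ennreal_le_coe_ennreal_iff.2
    (haccel.trans le_add_self))) _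

end RelaxedF

/-- The first variation at `Δ = 0` of the relaxed energy of a geodesic, run with the time change
`α`, in the direction of the defect `α(t)² dt ⊗ δ_y`; `E` is the Jacobian of the geodesic at `y`. -/
def firstVariation (E α : ℝ → ℝ) : ℝ :=
  ∫ t in (0 : ℝ)..1, (E (α t) * deriv α t ^ 2 + deriv (deriv α) t * α t ^ 2 * deriv E (α t))

namespace IsTimeReparam

variable {α : ℝ → ℝ} (hα : IsTimeReparam α)
include hα

theorem contDiff_two : ContDiff ℝ 2 α := contDiff_infty.1 hα.smooth 2

theorem pos {t : ℝ} (ht : t ∈ Ioc (0 : ℝ) 1) : 0 < α t := by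
  have hmono : StrictMonoOn α (Icc 0 1) := strictMonoOn_of_deriv_pos (convex_Icc 0 1)
    hα.smooth.continuous.continuousOn fun s hs => hα.deriv_pos s (interior_subset hs)
  simpa only [hα.start] using
    hmono (left_mem_Icc.2 zero_le_one) (Ioc_subset_Icc_self ht) ht.1

theorem nonneg {t : ℝ} (ht : t ∈ Icc (0 : ℝ) 1) : 0 ≤ α t := by
  rcases ht.1.eq_or_lt with rfl | h0
  · exact hα.start.ge
  · exact (hα.pos ⟨h0, ht.2⟩).le

end IsTimeReparam

namespace IsCompleteGeodesic

variable {p q : ℝ → L2} (h : IsCompleteGeodesic p q) {y : ℝ} (hy : y ∈ Icc (0 : ℝ) 1)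
include h hy

theorem deriv_eta (t : ℝ) : deriv (fun t => eta (q t) y) t =
    eta (q t) y * innerEta (q t) (p t) ((Iic y).indicator 1) :=
  (h.hasDerivAt_eta hy t).deriv

theorem contDiff_eta : ContDiff ℝ 1 fun t => eta (q t) y := by
  refine contDiff_one_iff_deriv.2 ⟨fun t => (h.hasDerivAt_eta hy t).differentiableAt, ?_⟩
  rw [funext (h.deriv_eta hy)]
  exact h.continuous_deriv_eta hy

variable {α ρ : ℝ → ℝ} (hα : ContDiff ℝ 2 α) (hρ : Measurable ρ)
  (hρ₀ : ∀ t ∈ Icc (0 : ℝ) 1, 0 ≤ ρ t) {Δ : FiniteMeasure (ℝ × ℝ)}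
  (hΔ : (Δ : Measure (ℝ × ℝ)) = lineMeas y ρ)
include hα hρ hρ₀ hΔ

theorem relaxedAccelEnergy_eq :
    relaxedAccelEnergy (fun t => deriv α t • p (α t)) (fun t => q (α t)) Δ =
      ∫⁻ t in Icc (0 : ℝ) 1, ENNReal.ofReal (innerEta (q (α t))
        (fun x => deriv (deriv α) t * p (α t) x + 1 / 2 * ρ t * eta (q (α t)) y *
          projStar (q (α t)) ((Iic y).indicator 1) x)
        (fun x => deriv (deriv α) t * p (α t) x + 1 / 2 * ρ t * eta (q (α t)) y *
          projStar (q (α t)) ((Iic y).indicator 1) x)) := by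
  refine lintegral_congr_ae ?_
  filter_upwards [slice_lineMeas hρ hΔ, ae_leb01_of_forall hρ₀] with t hslice hnonneg
  rw [hslice]
  exact lintegral_eta_mul_add_projStar_opUMeas_sq (h.accelFlat_reparam hα t) hnonneg hy.2

end IsCompleteGeodesic

/-- An upper bound for the squared norm of the relaxed acceleration at time `t`, when the geodesic
`(p, q)` is run with the time change `α` and carries the defect `ρ(t) dt ⊗ δ_y`. -/
def accelBound (p q : ℝ → L2) (y : ℝ) (α ρ : ℝ → ℝ) (t : ℝ) : ℝ :=
  deriv (deriv α) t ^ 2 * innerEta (q (α t)) (p (α t)) (p (α t)) +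
    deriv (deriv α) t * ρ t * deriv (fun s => eta (q s) y) (α t) +
    (1 / 2 * ρ t * eta (q (α t)) y) ^ 2

namespace IsCompleteGeodesic

variable {p q : ℝ → L2} (h : IsCompleteGeodesic p q) {α : ℝ → ℝ}
include h

theorem continuous_accel_self (hα : ContDiff ℝ 2 α) : Continuous fun t =>
    deriv (deriv α) t ^ 2 * innerEta (q (α t)) (p (α t)) (p (α t)) :=
  ((continuous_deriv_deriv_of_contDiff_two hα).pow 2).mul
    (h.continuous_innerEta_self.comp hα.continuous)

theorem le_relaxedF_zero (hα : ContDiff ℝ 2 α) (P : L2 → L2 → ℝ) :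
    (((∫ t in (0 : ℝ)..1, deriv (deriv α) t ^ 2 * innerEta (q (α t)) (p (α t)) (p (α t))) +
        P (deriv α 1 • p (α 1)) (q (α 1)) : ℝ) : EReal) ≤
      relaxedF P (fun t => deriv α t • p (α t)) (fun t => q (α t)) 0 := by
  have hzero : ((0 : FiniteMeasure (ℝ × ℝ)) : Measure (ℝ × ℝ)) = lineMeas 0 fun _ => 0 := by
    simp [lineMeas]
  refine le_relaxedF (P := P) (p := fun t => deriv α t • p (α t)) (q := fun t => q (α t))
    (le_of_eq ?_)
  rw [h.relaxedAccelEnergy_eq (left_mem_Icc.2 zero_le_one) hα measurable_const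
    (fun _ _ => le_rfl) hzero, ← lintegral_ofReal_leb01
    (h.continuous_accel_self hα).integrableOn_Icc (ae_of_all _ fun t =>
      mul_nonneg (sq_nonneg _) (innerEta_self_nonneg _ _))]
  refine lintegral_congr fun t => ?_
  simp only [mul_zero, zero_mul, add_zero]
  rw [innerEta_const_mul, innerEta_comm _ _ fun x => deriv (deriv α) t * p (α t) x,
    innerEta_const_mul, ← mul_assoc, pow_two]

variable {y : ℝ} (hy : y ∈ Icc (0 : ℝ) 1)
include hy

theorem innerEta_accel_defect_le (α ρ : ℝ → ℝ) (t : ℝ) : innerEta (q (α t))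
      (fun x => deriv (deriv α) t * p (α t) x + 1 / 2 * ρ t * eta (q (α t)) y *
        projStar (q (α t)) ((Iic y).indicator 1) x)
      (fun x => deriv (deriv α) t * p (α t) x + 1 / 2 * ρ t * eta (q (α t)) y *
        projStar (q (α t)) ((Iic y).indicator 1) x) ≤ accelBound p q y α ρ t := by
  rw [accelBound, h.deriv_eta hy]
  have hproj := innerEta_add_projStar_self_le (h.mem_Q (α t)) (h.mem_cotangent (α t))
    (memLp_indicator_Iic y) (deriv (deriv α) t) (1 / 2 * ρ t * eta (q (α t)) y)
  have hindicator := mul_le_mul_of_nonneg_left (innerEta_indicator_Iic_self_le (h.mem_Q (α t)) hy)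
    (sq_nonneg (1 / 2 * ρ t * eta (q (α t)) y))
  linarith

theorem accelBound_nonneg (α ρ : ℝ → ℝ) (t : ℝ) : 0 ≤ accelBound p q y α ρ t :=
  (innerEta_self_nonneg _ _).trans (h.innerEta_accel_defect_le hy α ρ t)

variable (hα : ContDiff ℝ 2 α) {ρ : ℝ → ℝ}
include hα

theorem continuous_accelBound (hρ : Continuous ρ) : Continuous (accelBound p q y α ρ) := by
  have hE := (h.contDiff_eta hy).continuous.comp hα.continuous
  have hE' := ((h.contDiff_eta hy).continuous_deriv le_rfl).comp hα.continuous
  exact ((h.continuous_accel_self hα).add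
    (((continuous_deriv_deriv_of_contDiff_two hα).mul hρ).mul hE')).add
    (((continuous_const.mul hρ).mul hE).pow 2)

theorem relaxedAccelEnergy_le (hρ : Continuous ρ) (hρ₀ : ∀ t ∈ Icc (0 : ℝ) 1, 0 ≤ ρ t)
    {Δ : FiniteMeasure (ℝ × ℝ)} (hΔ : (Δ : Measure (ℝ × ℝ)) = lineMeas y ρ) :
    relaxedAccelEnergy (fun t => deriv α t • p (α t)) (fun t => q (α t)) Δ ≤
      ENNReal.ofReal (∫ t in (0 : ℝ)..1, accelBound p q y α ρ t) := by
  rw [h.relaxedAccelEnergy_eq hy hα hρ.measurable hρ₀ hΔ, ← lintegral_ofReal_leb01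
    (h.continuous_accelBound hy hα hρ).integrableOn_Icc
    (ae_of_all _ (h.accelBound_nonneg hy α ρ))]
  exact lintegral_mono fun t => ENNReal.ofReal_le_ofReal (h.innerEta_accel_defect_le hy α ρ t)

end IsCompleteGeodesic

namespace IsTimeReparam

variable {α : ℝ → ℝ} (hα : IsTimeReparam α)
include hα

theorem ae_pos : ∀ᵐ t ∂leb01, 0 < α t := by
  filter_upwards [ae_leb01_of_forall (p := (· ∈ Icc (0 : ℝ) 1)) fun _ ht => ht,
    Measure.ae_ne leb01 0] with t ht hne using hα.pos ⟨ht.1.lt_of_ne' hne, ht.2⟩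

theorem exists_isTimeDeriv_lineMeas {y ε : ℝ} (hy : y ∈ Icc (0 : ℝ) 1) (hε : 0 < ε) :
    ∃ δ, IsTimeDeriv (lineMeas y fun t => ε * α t ^ 2) δ ∧ ∀ f,
      fisherRao f (lineMeas y fun t => ε * α t ^ 2) δ =
        ∫⁻ t in Icc (0 : ℝ) 1, ENNReal.ofReal (ε * deriv α t ^ 2) * ENNReal.ofReal (f (t, y)) := by
  set ρ : ℝ → ℝ := fun t => ε * α t ^ 2
  set ρ' : ℝ → ℝ := fun t => 2 * ε * α t * deriv α t
  have hcont : Continuous α := hα.smooth.continuous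
  have hcont' : Continuous (deriv α) := hα.contDiff_two.continuous_deriv one_le_two
  have hcontρ : Continuous ρ := by fun_prop
  have hcontρ' : Continuous ρ' := by fun_prop
  have hderiv (t : ℝ) : HasDerivAt ρ (ρ' t) t := by
    refine (((hasDerivAt_of_contDiff_two hα.contDiff_two t).fun_pow 2).const_mul ε).congr_deriv ?_
    simp only [ρ']
    ring
  have hρ'₀ : ∀ t ∈ Icc (0 : ℝ) 1, 0 ≤ ρ' t := fun t ht =>
    mul_nonneg (mul_nonneg (by positivity) (hα.nonneg ht)) (hα.deriv_pos t ht).le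
  have := isFiniteMeasure_lineMeas (y := y) hcontρ'.integrableOn_Icc
  refine ⟨_, isTimeDeriv_lineMeas hy hderiv hcontρ' (fun t _ => by positivity) hρ'₀
    (by simp only [ρ, hα.start]; ring), fun f => ?_⟩
  rw [fisherRao_lineMeas hcontρ.measurable hcontρ'.measurable
    (hα.ae_pos.mono fun t ht => by positivity) (ae_leb01_of_forall hρ'₀)]
  refine lintegral_congr_ae ?_
  filter_upwards [hα.ae_pos] with t ht
  congr 2
  simp only [ρ, ρ']
  field_simp
  ring

end IsTimeReparam

namespace IsCompleteGeodesic

variable {p q : ℝ → L2} (h : IsCompleteGeodesic p q) {y : ℝ} (hy : y ∈ Icc (0 : ℝ) 1)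
  {α : ℝ → ℝ} (hα : IsTimeReparam α)
include h hy hα

theorem exists_fisherRaoPath_le {ε : ℝ} (hε : 0 < ε) : ∃ Δ ∈ M0,
    (Δ : Measure (ℝ × ℝ)) = lineMeas y (fun t => ε * α t ^ 2) ∧
    fisherRaoPath (fun t => q (α t)) Δ ≤
      ENNReal.ofReal (∫ t in (0 : ℝ)..1, ε * (eta (q (α t)) y * deriv α t ^ 2)) := by
  obtain ⟨δ, hδ, hFR⟩ := hα.exists_isTimeDeriv_lineMeas hy hε
  have hcont : Continuous α := hα.smooth.continuous
  have hdens : Continuous fun t => ε * α t ^ 2 := by fun_prop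
  have hintegrand : Continuous fun t => ε * (eta (q (α t)) y * deriv α t ^ 2) :=
    continuous_const.mul (((h.contDiff_eta hy).continuous.comp hcont).mul
      ((hα.contDiff_two.continuous_deriv one_le_two).pow 2))
  refine ⟨⟨_, isFiniteMeasure_lineMeas hdens.integrableOn_Icc⟩,
    ⟨lineMeas_compl_D hdens.measurable hy, δ, hδ⟩, rfl,
    (iInf₂_le δ hδ).trans_eq ((hFR _).trans ?_)⟩
  rw [← lintegral_ofReal_leb01 hintegrand.integrableOn_Icc (ae_of_all _ fun t =>
    mul_nonneg hε.le (mul_nonneg (eta_pos _ _).le (sq_nonneg _)))]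
  refine lintegral_congr fun t => ?_
  rw [← ENNReal.ofReal_mul (by positivity), mul_right_comm, mul_assoc]

theorem integral_add_integral_accelBound (ε : ℝ) :
    (∫ t in (0 : ℝ)..1, ε * (eta (q (α t)) y * deriv α t ^ 2)) +
        ∫ t in (0 : ℝ)..1, accelBound p q y α (fun t => ε * α t ^ 2) t =
      (∫ t in (0 : ℝ)..1, deriv (deriv α) t ^ 2 * innerEta (q (α t)) (p (α t)) (p (α t))) +
        ε * firstVariation (fun s => eta (q s) y) α +
        ε ^ 2 * ∫ t in (0 : ℝ)..1, (1 / 2 * α t ^ 2 * eta (q (α t)) y) ^ 2 := by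
  have hcont : Continuous α := hα.smooth.continuous
  have hcont' : Continuous (deriv α) := hα.contDiff_two.continuous_deriv one_le_two
  have hcont'' := continuous_deriv_deriv_of_contDiff_two hα.contDiff_two
  have hE := (h.contDiff_eta hy).continuous.comp hcont
  have hE' := ((h.contDiff_eta hy).continuous_deriv le_rfl).comp hcont
  simp only [Function.comp_def] at hE hE'
  have hbound := h.continuous_accelBound hy hα.contDiff_two (ρ := fun t => ε * α t ^ 2)
    (by fun_prop)
  have haccel := h.continuous_accel_self hα.contDiff_two
  rw [firstVariation, ← intervalIntegral.integral_const_mul, ← intervalIntegral.integral_const_mul,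
    ← intervalIntegral.integral_add (Continuous.intervalIntegrable (by fun_prop) _ _)
      (hbound.intervalIntegrable _ _),
    ← intervalIntegral.integral_add (haccel.intervalIntegrable _ _)
      (Continuous.intervalIntegrable (by fun_prop) _ _),
    ← intervalIntegral.integral_add (Continuous.intervalIntegrable (by fun_prop) _ _)
      (Continuous.intervalIntegrable (by fun_prop) _ _)]
  refine intervalIntegral.integral_congr fun t _ => ?_
  simp only [accelBound]
  ring

theorem exists_relaxedF_le {ε : ℝ} (hε : 0 < ε) (P : L2 → L2 → ℝ) : ∃ Δ ∈ M0,
    relaxedF P (fun t => deriv α t • p (α t)) (fun t => q (α t)) Δ ≤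
      (((∫ t in (0 : ℝ)..1, deriv (deriv α) t ^ 2 * innerEta (q (α t)) (p (α t)) (p (α t))) +
        ε * firstVariation (fun s => eta (q s) y) α +
        ε ^ 2 * (∫ t in (0 : ℝ)..1, (1 / 2 * α t ^ 2 * eta (q (α t)) y) ^ 2) +
        P (deriv α 1 • p (α 1)) (q (α 1)) : ℝ) : EReal) := by
  obtain ⟨Δ, hM0, hline, hFR⟩ := h.exists_fisherRaoPath_le hy hα hε
  refine ⟨Δ, hM0, ?_⟩
  have hcont : Continuous α := hα.smooth.continuous
  rw [← h.integral_add_integral_accelBound hy hα]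
  exact relaxedF_le
    (intervalIntegral.integral_nonneg zero_le_one fun t _ =>
      mul_nonneg hε.le (mul_nonneg (eta_pos _ _).le (sq_nonneg _)))
    (intervalIntegral.integral_nonneg zero_le_one fun t _ => h.accelBound_nonneg hy α _ t)
    hFR (h.relaxedAccelEnergy_le hy hα.contDiff_two (by fun_prop) (fun t _ => by positivity) hline)

theorem not_isMinOn_relaxedF (hneg : firstVariation (fun s => eta (q s) y) α < 0)
    (P : L2 → L2 → ℝ) :
    ¬ IsMinOn (relaxedF P (fun t => deriv α t • p (α t)) (fun t => q (α t))) M0 0 := by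
  set I := firstVariation (fun s => eta (q s) y) α
  set J := ∫ t in (0 : ℝ)..1, (1 / 2 * α t ^ 2 * eta (q (α t)) y) ^ 2
  have hJ : 0 ≤ J := intervalIntegral.integral_nonneg zero_le_one fun t _ => sq_nonneg _
  obtain ⟨ε, hε, hdecrease⟩ : ∃ ε > 0, ε * I + ε ^ 2 * J < 0 := by
    have hJ1 : 0 < J + 1 := by positivity
    refine ⟨-I / (J + 1), div_pos (neg_pos.2 hneg) hJ1, ?_⟩
    have hvalue : -I / (J + 1) * I + (-I / (J + 1)) ^ 2 * J = -(I / (J + 1)) ^ 2 := by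
      field_simp
      ring
    rw [hvalue]
    exact neg_lt_zero.2 (sq_pos_of_ne_zero (div_ne_zero hneg.ne hJ1.ne'))
  obtain ⟨Δ, hM0, hle⟩ := h.exists_relaxedF_le hy hα hε P
  intro hmin
  have hcompare := ((h.le_relaxedF_zero hα.contDiff_two P).trans (hmin hM0)).trans hle
  rw [EReal.coe_le_coe_iff] at hcompare
  linarith

end IsCompleteGeodesic

/-! ### A time change with negative first variation -/

section ExpTime

/-- The solution of `α' = l (α + A)` with `α(0) = 0`: an exponential time change. -/
def expTime (A l t : ℝ) : ℝ := A * (Real.exp (l * t) - 1)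

variable (A l : ℝ)

theorem hasDerivAt_expTime (t : ℝ) :
    HasDerivAt (expTime A l) (l * (expTime A l t + A)) t := by
  refine (((((hasDerivAt_id t).const_mul l).exp).sub_const 1).const_mul A).congr_deriv ?_
  simp only [expTime, id]
  ring

theorem deriv_expTime : deriv (expTime A l) = fun t => l * (expTime A l t + A) :=
  funext fun t => (hasDerivAt_expTime A l t).deriv

theorem deriv_deriv_expTime :
    deriv (deriv (expTime A l)) = fun t => l * (l * (expTime A l t + A)) := by
  rw [deriv_expTime]
  exact funext fun t => (((hasDerivAt_expTime A l t).add_const A).const_mul l).deriv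

theorem contDiff_expTime : ContDiff ℝ ∞ (expTime A l) := by
  unfold expTime
  fun_prop

theorem expTime_zero : expTime A l 0 = 0 := by simp [expTime]

variable {A l}

theorem isTimeReparam_expTime (hA : 0 < A) (hl : 0 < l) : IsTimeReparam (expTime A l) where
  smooth := contDiff_expTime A l
  start := expTime_zero A l
  deriv_pos t _ := by
    have hsum : expTime A l t + A = A * Real.exp (l * t) := by
      rw [expTime]
      ring
    rw [(hasDerivAt_expTime A l t).deriv, hsum]
    positivity

theorem exists_expTime_one_eq {R : ℝ} (hA : 0 < A) (hR : 0 < R) : ∃ l > 0, expTime A l 1 = R := by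
  have hRA : 0 < R / A := by positivity
  refine ⟨Real.log (1 + R / A), Real.log_pos (by linarith), ?_⟩
  rw [expTime, mul_one, Real.exp_log (by linarith)]
  field_simp
  ring

end ExpTime

section FirstVariation

theorem integral_mul_id_le {E : ℝ → ℝ} (hE : Continuous E) (hpos : ∀ s, 0 ≤ E s) {R : ℝ}
    (hR : 1 ≤ R) :
    ∫ r in (0 : ℝ)..1, E r * r ≤ ∫ r in (0 : ℝ)..R, E r * r := by
  have hint (x y : ℝ) : IntervalIntegrable (fun r => E r * r) volume x y :=
    Continuous.intervalIntegrable (by fun_prop) _ _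
  rw [← intervalIntegral.integral_add_adjacent_intervals (hint 0 1) (hint 1 R)]
  exact le_add_of_nonneg_right (intervalIntegral.integral_nonneg hR fun r hr =>
    mul_nonneg (hpos r) (zero_le_one.trans hr.1))

variable {E : ℝ → ℝ} (hE : ContDiff ℝ 1 E)
include hE

theorem firstVariation_expTime (A l : ℝ) : firstVariation E (expTime A l) =
    l * (E (expTime A l 1) * expTime A l 1 ^ 2 +
      ∫ r in (0 : ℝ)..expTime A l 1, E r * (A - r)) := by
  have hcont := hE.continuous
  have := hE.continuous_deriv le_rfl
  have hcontα := (contDiff_expTime A l).continuous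
  have hintegrand : Continuous fun r => E r * (A - r) := by fun_prop
  have hprimitive (t : ℝ) : HasDerivAt (fun t => l * (E (expTime A l t) * expTime A l t ^ 2 +
      ∫ r in (0 : ℝ)..expTime A l t, E r * (A - r)))
      (E (expTime A l t) * (l * (expTime A l t + A)) ^ 2 +
        l * (l * (expTime A l t + A)) * expTime A l t ^ 2 * deriv E (expTime A l t)) t := by
    have hα := hasDerivAt_expTime A l t
    have hEα := ((hE.differentiable one_ne_zero (expTime A l t)).hasDerivAt).comp t hα
    have hintegral :=
      (hintegrand.integral_hasStrictDerivAt 0 (expTime A l t)).hasDerivAt.comp t hα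
    refine (((hEα.fun_mul (hα.fun_pow 2)).fun_add hintegral).const_mul l).congr_deriv ?_
    simp only [Function.comp_def]
    ring
  rw [firstVariation, deriv_deriv_expTime, deriv_expTime,
    intervalIntegral.integral_eq_sub_of_hasDerivAt (fun t _ => hprimitive t)
      (Continuous.intervalIntegrable (by fun_prop) _ _), expTime_zero,
    intervalIntegral.integral_same]
  ring

theorem exists_isTimeReparam_firstVariation_neg (hpos : ∀ s, 0 < E s)
    (hlim : Tendsto (fun s => E s * s ^ 2) atTop (𝓝 0)) :
    ∃ α, IsTimeReparam α ∧ firstVariation E α < 0 := by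
  have hcont := hE.continuous
  have hint (x y : ℝ) : IntervalIntegrable E volume x y := hcont.intervalIntegrable x y
  set J : ℝ := ∫ r in (0 : ℝ)..1, E r * r
  have hJ : 0 < J := intervalIntegral.intervalIntegral_pos_of_pos_on
    (Continuous.intervalIntegrable (by fun_prop) _ _) (fun r hr => mul_pos (hpos r) hr.1)
    zero_lt_one
  obtain ⟨R, hRJ, hR⟩ : ∃ R, E R * R ^ 2 < J / 2 ∧ 1 ≤ R :=
    ((hlim.eventually (gt_mem_nhds (half_pos hJ))).and (eventually_ge_atTop 1)).exists
  have hR0 : 0 < R := zero_lt_one.trans_le hR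
  set M : ℝ := ∫ r in (0 : ℝ)..R, E r
  have hM : 0 < M := intervalIntegral.intervalIntegral_pos_of_pos (hint 0 R) hpos hR0
  set A : ℝ := J / (4 * M)
  have hA : 0 < A := by positivity
  obtain ⟨l, hl, hend⟩ := exists_expTime_one_eq hA hR0
  refine ⟨expTime A l, isTimeReparam_expTime hA hl, ?_⟩
  have hsplit : ∫ r in (0 : ℝ)..R, E r * (A - r) = A * M - ∫ r in (0 : ℝ)..R, E r * r := by
    rw [← intervalIntegral.integral_const_mul, ← intervalIntegral.integral_sub
      ((hint 0 R).const_mul A) (Continuous.intervalIntegrable (by fun_prop) _ _)]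
    exact intervalIntegral.integral_congr fun r _ => by ring
  have hAM : A * M = J / 4 := by
    simp only [A]
    field_simp
  have hmoment := integral_mul_id_le hcont (fun s => (hpos s).le) hR
  rw [firstVariation_expTime hE, hend, hsplit]
  exact mul_neg_of_pos_of_neg hl (by linarith)

end FirstVariation

theorem IsCompleteGeodesic.exists_isTimeReparam_not_isMinOn {p q : ℝ → L2}
    (h : IsCompleteGeodesic p q) {y : ℝ} (hy : y ∈ Icc (0 : ℝ) 1)
    (hlim : Tendsto (fun t => eta (q t) y * t ^ 2) atTop (𝓝 0)) :
    ∃ α, IsTimeReparam α ∧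
      IsCurve (deriv α 0 • p (α 0)) (q (α 0)) (fun t => deriv α t • p (α t)) (fun t => q (α t)) ∧
      ∀ P, ¬ IsMinOn (relaxedF P (fun t => deriv α t • p (α t)) (fun t => q (α t))) M0 0 := by
  obtain ⟨α, hα, hneg⟩ :=
    exists_isTimeReparam_firstVariation_neg (h.contDiff_eta hy) (fun t => eta_pos _ _) hlim
  exact ⟨α, hα, h.isCurve_reparam hα.contDiff_two, h.not_isMinOn_relaxedF hy hα hneg⟩

namespace IsLandmarkFlow

variable {a k : ℝ → ℝ} {U φ : ℝ → ℝ → ℝ} (hF : IsLandmarkFlow a k U φ) (h : IsTrajectory a k)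
include hF h

theorem eta_flowQ_half (t : ℝ) :
    eta (flowQ (fun t => landmarkFieldDeriv₂ (a t) (k t)) U φ t) (1 / 2) =
      Real.exp (U t (1 / 2)) :=
  hF.eta_flowQ h.isClampedField t ⟨by norm_num, by norm_num⟩

variable {c : ℝ} (hc0 : 0 < c) (hc : ∀ t, 0 ≤ t → c ≤ k t * a t ^ 2)
include hc0 hc

theorem strictAntiOn_eta_half : StrictAntiOn
    (fun t => eta (flowQ (fun t => landmarkFieldDeriv₂ (a t) (k t)) U φ t) (1 / 2)) (Ici 0) := by
  simp only [hF.eta_flowQ_half h]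
  exact Real.exp_strictMono.comp_strictAntiOn (hF.strictAntiOn_logJac_half h hc0 hc)

theorem tendsto_eta_half_mul_pow (n : ℕ) : Tendsto
    (fun t => eta (flowQ (fun t => landmarkFieldDeriv₂ (a t) (k t)) U φ t) (1 / 2) * t ^ n)
    atTop (𝓝 0) := by
  have hdecay : Tendsto (fun t => t ^ n * Real.exp (-(3 / 4 * c) * t)) atTop (𝓝 0) := by
    simpa only [Real.rpow_natCast] using
      tendsto_rpow_mul_exp_neg_mul_atTop_nhds_zero n (3 / 4 * c) (by positivity)
  refine tendsto_of_tendsto_of_tendsto_of_le_of_le' tendsto_const_nhds hdecay ?_ ?_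
  · filter_upwards [eventually_ge_atTop 0] with t ht
      using mul_nonneg (eta_pos _ _).le (pow_nonneg ht n)
  · filter_upwards [eventually_ge_atTop 0] with t ht
    rw [hF.eta_flowQ_half h, mul_comm, neg_mul]
    gcongr
    exact hF.logJac_half_le h hc ht

end IsLandmarkFlow

end DiffSpline

end

theorem mainTheorem5 :
    ∃ p₀ q₀ : ℝ → DiffSpline.L2,
      DiffSpline.IsLandmarkGeodesic ![1, -1] ![1 / 4, 3 / 4] p₀ q₀ ∧
      StrictAntiOn (fun t => DiffSpline.eta (q₀ t) (1 / 2)) (Set.Ici 0) ∧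
      Filter.Tendsto (fun t => DiffSpline.eta (q₀ t) (1 / 2)) Filter.atTop (nhds 0) ∧
      ∃ α : ℝ → ℝ, DiffSpline.IsTimeReparam α ∧
        ∃ p q : ℝ → DiffSpline.L2,
          (∀ t, p t = deriv α t • p₀ (α t)) ∧ (∀ t, q t = q₀ (α t)) ∧
          DiffSpline.IsCurve (p 0) (q 0) p q ∧
          ∀ P : DiffSpline.L2 → DiffSpline.L2 → ℝ,
            ¬ IsMinOn (DiffSpline.relaxedF P p q) DiffSpline.M0 0 := by
  obtain ⟨a, k, h, c, hc0, hc⟩ := DiffSpline.exists_isTrajectory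
  obtain ⟨U, φ, hF⟩ := h.isClampedField.exists_isFlow
  replace hF : DiffSpline.IsLandmarkFlow a k U φ := hF
  have hgeo := (hF.isGeodesicFlow h).isCompleteGeodesic
  obtain ⟨α, hα, hcurve, hmin⟩ := hgeo.exists_isTimeReparam_not_isMinOn (y := 1 / 2)
    ⟨by norm_num, by norm_num⟩ (hF.tendsto_eta_half_mul_pow h hc0 hc 2)
  have hlim := hF.tendsto_eta_half_mul_pow h hc0 hc 0
  simp only [pow_zero, mul_one] at hlim
  exact ⟨_, _, hF.isLandmarkGeodesic h, hF.strictAntiOn_eta_half h hc0 hc, hlim, α, hα, _, _,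
    fun _ => rfl, fun _ => rfl, hcurve, hmin⟩
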